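/- Let $r\ge 0$ be an integer and $z\in\mathbb C$. A partial permutation of $\{1,\dots,r\}$ is a bijection $d:\operatorname{dom}(d)\to\operatorname{im}(d)$ between two subsets, and $\operatorname{rank}(d)=|\operatorname{dom}(d)|$. Maps are written on the right of their arguments, so $d_1\circ d_2$ means first $d_1$, then $d_2$. Let $A=\mathcal{PP}_r(z)$ be the complex algebra whose basis is the set $\mathscr A$ of partial permutations, with product $d_1d_2=z^N(d_1\circ d_2)$, where $N=r-|\operatorname{im}(d_1)\cup\operatorname{dom}(d_2)|$; it has the linear anti-involution $*$ with $d^*=d^{-1}$. For $0\le k\le r$ let $\mathscr U(k)$ be the set of $k$-element subsets of $\{1,\dots,r\}$, let $U(k)=\mathbb C\,\mathscr U(k)$, and let $B(k)=\mathbb CS_k$ (permutations also act on the right), with the linear anti-involution $*$ given by $w^*=w^{-1}$. For a partial permutation $d$ of rank $k$ let $\pi(d)\in S_k$ send $i$ to $j$ when $d$ sends the $i$-th smallest element of $\operatorname{dom}(d)$ to the $j$-th smallest element of $\operatorname{im}(d)$. For $a\in\mathscr A$ and $u\in\mathscr U(k)$ put $$\phi_k(a,u)=z^{\,r-\operatorname{rank}(a)}\,(u)a^{-1},\qquad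 \theta_k(a,u)=\pi\bigl(a|_{(u)a^{-1}}\bigr)\qquad\text{if }u\subseteq\operatorname{im}(a),$$ where $(u)a^{-1}$ is the preimage of $u$, and $\phi_k(a,u)=0$, $\theta_k(a,u)=0$ otherwise. Let $\Lambda=\{(k,\lambda):0\le k\le r,\ \lambda\vdash k\}$. Cell data and cell modules are those of Graham and Lehrer: a cell datum of an algebra with anti-involution $*$ consists of a poset, finite sets $M(\lambda)$ indexed by it, and a basis $C^\lambda_{S,T}$ ($S,T\in M(\lambda)$) with $(C^\lambda_{S,T})^*=C^\lambda_{T,S}$ and $aC^\lambda_{S,T}\equiv\sum_{S'}r_a(S',S)\,C^\lambda_{S',T}$ modulo the span of the $C^\mu_{X,Y}$ with $\mu<\lambda$, where $r_a(S',S)$ does not depend on $T$; the cell module of $\lambda$ has basis $M(\lambda)$ and action $aS=\sum_{S'}r_a(S',S)S'$. An algebra with anti-involution is cellular if it has a cell datum with finite index set. **Iterated inflation.** The algebra $A$ is an iterated inflation of the cellular algebras $B(k)=\mathbb CS_k$, $0\le k\le r$. That is: each $B(k)$ is cellular with respect to $*$; the linear map with $d\mapsto\operatorname{dom}(d)\otimes\pi(d)\otimes\operatorname{im}(d)$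 is an isomorphism $A\cong\bigoplus_{k=0}^rU(k)\otimes B(k)\otimes U(k)$; and under this identification $(u\otimes b\otimes v)^*=v\otimes b^*\otimes u$ and $$a(u\otimes b\otimes v)\equiv\phi_k(a,u)\otimes\theta_k(a,u)b\otimes v\pmod{J(<k)}$$ for all $k$, $a\in\mathscr A$, $u,v\in\mathscr U(k)$, $b\in B(k)$, where $J(<k)=\bigoplus_{j<k}U(j)\otimes B(j)\otimes U(j)$. Furthermore: (a) For every $0\le k\le r$ let any cell datum of $(B(k),*)$ be given whose index set is the set of partitions of $k$ (with any partial order); denote its basis by $C^\lambda_{X,Y}$ and its cell modules by $S^\lambda$. Then the elements $x\otimes C^\lambda_{X,Y}\otimes y$ $(x,y\in\mathscr U(k))$ form a cell datum of $(A,*)$ with index set $\Lambda$, ordered lexicographically, and sets $\mathscr U(k)\times M(\lambda)$. Its cell module for $\lambda\vdash k$ is $C(\lambda)=U(k)\otimes S^\lambda$, where the basis vector of $(x,X)$ corresponds to $x\otimes X$ and the action is $$a(x\otimes s)=\phi_k(a,x)\otimes\theta_k(a,x)s\qquad(a\in\mathscr A,\ x\in\mathscr U(k),\ s\in S^\lambda).$$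 Moreover such cell data of the $B(k)$ exist for which, for every $\lambda\vdash k$, the cell module $S^\lambda$ is isomorphic to the Specht module $\mathbb CS_k\,b_Ta_T$ for every tableau $T$ of shape $\lambda$, where $a_T$ is the sum of the permutations preserving the rows of $T$ and $b_T$ is the signed sum of those preserving its columns; and these Specht modules are irreducible. (b) Let $\psi_k:U(k)\times U(k)\to B(k)$ be the bilinear form with $\psi_k(y,u)=z^{r-k}\cdot1$ if $y=u$ and $\psi_k(y,u)=0$ otherwise, for $y,u\in\mathscr U(k)$. Then $\psi_k(y,u)^*=\psi_k(u,y)$ and $$(x\otimes c\otimes y)(u\otimes b\otimes v)\equiv x\otimes c\,\psi_k(y,u)\,b\otimes v\pmod{J(<k)}$$ for all $x,y,u,v\in U(k)$ and $b,c\in B(k)$. (c) If $z\ne0$, then $A$ is semisimple and, for every choice of cell data as in (a), the cell modules $C(\lambda)$, $\lambda\in\Lambda$, form a complete set of irreducible $A$-modules: each is irreducible, no two with distinct indices are isomorphic, and every irreducible $A$-module is isomorphic to one of them. -/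

import Mathlib

open scoped TensorProduct DirectSum

noncomputable section

namespace PartialPerm

/-! ### Cellular algebras -/

section Cellular

variable {R A : Type*} [CommRing R] [Ring A] [Algebra R A]

/-- An `R`-linear map of an algebra to itself is an anti-involution if it reverses products and is
its own inverse. -/
def IsAntiInvolution (s : A →ₗ[R] A) : Prop :=
  (∀ a b, s (a * b) = s b * s a) ∧ ∀ a, s (s a) = a

/-- A cell datum (Graham and Lehrer) on the algebra `A` with anti-involution `s`: a poset `Λ`,
finite sets `M l`, and a basis `C l S T` (`S T : M l`) of `A` that `s` permutes by exchanging
`S` and `T` and such that `a * C l S T ≡ ∑ S', r l a S' S • C l S' T` modulo the span of the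
`C m X Y` with `m < l`, where `r l a S' S` does not depend on `T`. -/
structure CellDatum (s : A →ₗ[R] A) (Λ : Type*) [PartialOrder Λ] (M : Λ → Type*)
    [∀ l, Fintype (M l)] where
  C : Module.Basis (Σ l, M l × M l) R A
  anti : IsAntiInvolution s
  star_C : ∀ l S T, s (C ⟨l, S, T⟩) = C ⟨l, T, S⟩
  r : ∀ l, A → Matrix (M l) (M l) R
  mul_C : ∀ l a S T, a * C ⟨l, S, T⟩ - ∑ S', r l a S' S • C ⟨l, S', T⟩ ∈
    Submodule.span R {x | ∃ m, m < l ∧ ∃ X Y : M m, x = C ⟨m, X, Y⟩}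

/-- An algebra with anti-involution is cellular if it has a cell datum with finite index set. -/
def IsCellular (s : A →ₗ[R] A) : Prop :=
  ∃ (Λ : Type) (_ : PartialOrder Λ) (_ : Finite Λ) (M : Λ → Type) (_ : ∀ l, Fintype (M l)),
    Nonempty (CellDatum s Λ M)

namespace CellDatum

variable {s : A →ₗ[R] A} {Λ : Type*} [PartialOrder Λ] {M : Λ → Type*} [∀ l, Fintype (M l)]
  (D : CellDatum s Λ M)

/-- The span of the basis elements `C m X Y` with `m < l`. -/
def lower (l : Λ) : Submodule R A :=
  Submodule.span R {x | ∃ m, m < l ∧ ∃ X Y : M m, x = D.C ⟨m, X, Y⟩}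

theorem repr_lower {l : Λ} {x : A} (hx : x ∈ D.lower l) (S T : M l) :
    D.C.repr x ⟨l, S, T⟩ = 0 := by
  have h : D.lower l ≤ LinearMap.ker (D.C.coord ⟨l, S, T⟩) := by
    refine Submodule.span_le.2 ?_
    rintro _ ⟨m, hm, X, Y, rfl⟩
    have hne : (⟨m, X, Y⟩ : Σ l, M l × M l) ≠ ⟨l, S, T⟩ := by
      intro h
      exact hm.ne (congrArg Sigma.fst h)
    simp [Finsupp.single_eq_of_ne hne.symm]
  simpa using h hx

theorem r_eq (l : Λ) (a : A) (S' S T : M l) :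
    D.r l a S' S = D.C.repr (a * D.C ⟨l, S, T⟩) ⟨l, S', T⟩ := by
  classical
  have h := D.repr_lower (D.mul_C l a S T) S' T
  rw [map_sub, Finsupp.sub_apply, sub_eq_zero] at h
  rw [h]
  simp [Finsupp.single_apply]

theorem mul_lower (l : Λ) (a : A) {x : A} (hx : x ∈ D.lower l) : a * x ∈ D.lower l := by
  have h : D.lower l ≤ (D.lower l).comap (LinearMap.mulLeft R a) := by
    refine Submodule.span_le.2 ?_
    rintro _ ⟨m, hm, X, Y, rfl⟩
    have h1 := D.mul_C m a X Y
    have h2 : D.lower m ≤ D.lower l := by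
      refine Submodule.span_mono ?_
      rintro _ ⟨n, hn, X, Y, rfl⟩
      exact ⟨n, hn.trans hm, X, Y, rfl⟩
    have h3 := (D.lower l).add_mem (h2 h1)
      ((D.lower l).sum_mem (t := Finset.univ) (f := fun S' => D.r m a S' X • D.C ⟨m, S', Y⟩)
        fun S' _ => (D.lower l).smul_mem _ (Submodule.subset_span ⟨m, hm, S', Y, rfl⟩))
    simpa using h3
  exact h hx

open Classical in
/-- The structure constants of a cell datum form a matrix representation. -/
def rep (l : Λ) : A →+* Matrix (M l) (M l) R where
  toFun := D.r l
  map_one' := by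
    ext S' S
    rw [D.r_eq l 1 S' S S, one_mul]
    simp [Finsupp.single_apply, Matrix.one_apply, eq_comm]
  map_zero' := by
    ext S' S
    rw [D.r_eq l 0 S' S S]
    simp
  map_add' a b := by
    ext S' S
    rw [Matrix.add_apply, D.r_eq l _ S' S S, D.r_eq l a S' S S, D.r_eq l b S' S S]
    simp [add_mul]
  map_mul' a b := by
    ext S' S
    rw [D.r_eq l (a * b) S' S S, mul_assoc]
    have h := D.repr_lower (D.mul_lower l a (D.mul_C l b S S)) S' S
    rw [mul_sub, map_sub, Finsupp.sub_apply, sub_eq_zero] at h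
    rw [h, Finset.mul_sum, map_sum, Finsupp.finsetSum_apply, Matrix.mul_apply]
    refine Finset.sum_congr rfl fun T _ => ?_
    rw [mul_smul_comm, map_smul, Finsupp.smul_apply, ← D.r_eq, smul_eq_mul, mul_comm]

/-- The cell module of `l`: the free module on `M l`, on which `a` sends the basis vector of `S`
to `∑ S', r l a S' S` times the basis vector of `S'`. -/
@[nolint unusedArguments]
def CellModule (_ : CellDatum s Λ M) (l : Λ) : Type _ := M l → R

instance (l : Λ) : AddCommGroup (D.CellModule l) := inferInstanceAs (AddCommGroup (M l → R))

instance (l : Λ) : Module R (D.CellModule l) := inferInstanceAs (Module R (M l → R))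

instance (l : Λ) : Module A (D.CellModule l) where
  smul a f := (D.rep l a).mulVec f
  one_smul f := by
    classical
    exact (congrArg (fun X => Matrix.mulVec X f) (map_one (D.rep l))).trans (Matrix.one_mulVec _)
  mul_smul a b f := (congrArg (fun X => Matrix.mulVec X f) (map_mul (D.rep l) a b)).trans
    (Matrix.mulVec_mulVec _ _ _).symm
  smul_zero a := Matrix.mulVec_zero _
  smul_add a f g := Matrix.mulVec_add _ _ _
  add_smul a b f := (congrArg (fun X => Matrix.mulVec X f) (map_add (D.rep l) a b)).trans
    (Matrix.add_mulVec _ _ _)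
  zero_smul f := (congrArg (fun X => Matrix.mulVec X f) (map_zero (D.rep l))).trans
    (Matrix.zero_mulVec _)

open Classical in
/-- The basis vector of the cell module that belongs to `S`. -/
def vec (l : Λ) (S : M l) : D.CellModule l := (Pi.single S 1 : M l → R)

end CellDatum

end Cellular

/-! ### Iterated inflations -/

section Inflation

variable {R : Type*} [CommRing R] {I : Type*} [DecidableEq I]
  (𝒰 : I → Type*) (B : I → Type*) [∀ i, Ring (B i)] [∀ i, Algebra R (B i)]

variable (R) in
/-- The direct sum of the `U i ⊗ B i ⊗ U i`, with `U i` the free module on the set `𝒰 i`. -/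
abbrev Layers : Type _ := ⨁ i, ((𝒰 i →₀ R) ⊗[R] B i) ⊗[R] (𝒰 i →₀ R)

variable {𝒰 B} {A : Type*} [Ring A] [Algebra R A]

/-- The element `u ⊗ b ⊗ v` of layer `i`, as an element of `A`. -/
def layer (e : A ≃ₗ[R] Layers R 𝒰 B) (i : I) (u : 𝒰 i →₀ R) (b : B i) (v : 𝒰 i →₀ R) : A :=
  e.symm (DirectSum.lof R I (fun i => ((𝒰 i →₀ R) ⊗[R] B i) ⊗[R] (𝒰 i →₀ R)) i (u ⊗ₜ b ⊗ₜ v))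

/-- `J(< i)`: the sum of the layers `j` with `j < i`. -/
def below [PartialOrder I] (e : A ≃ₗ[R] Layers R 𝒰 B) (i : I) : Submodule R A where
  carrier := {x | ∀ j, ¬ j < i → e x j = 0}
  zero_mem' j _ := by simp
  add_mem' hx hy j hj := by simp [hx j hj, hy j hj]
  smul_mem' c x hx j hj := by
    rw [map_smul, DirectSum.smul_apply, hx j hj, smul_zero]

/-- `A`, with anti-involution `s` and basis `𝒜`, is an iterated inflation of the cellular algebras
`B i` (with anti-involutions `t i`) along the based free modules `U i`, through the linear
isomorphism `e` of `A` with the sum of the `U i ⊗ B i ⊗ U i` and the maps `φ` and `θ`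
(Green and Paget, after König and Xi). -/
structure IsIteratedInflation [PartialOrder I] {α : Type*} (s : A →ₗ[R] A)
    (𝒜 : Module.Basis α R A) (t : ∀ i, B i →ₗ[R] B i) (e : A ≃ₗ[R] Layers R 𝒰 B)
    (φ : ∀ i, α → 𝒰 i → (𝒰 i →₀ R)) (θ : ∀ i, α → 𝒰 i → B i) : Prop where
  anti : IsAntiInvolution s
  cellular : ∀ i, IsCellular (t i)
  star_layer : ∀ i u b v, s (layer e i u b v) = layer e i v (t i b) u
  mul_layer : ∀ i (a : α) (u v : 𝒰 i) (b : B i),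
    𝒜 a * layer e i (Finsupp.single u 1) b (Finsupp.single v 1)
      - layer e i (φ i a u) (θ i a u * b) (Finsupp.single v 1) ∈ below e i

end Inflation

/-! ### Partial permutations

A partial permutation of `{1, …, r}` is an element of `Fin r ≃. Fin r`. Maps are written on the
right of their arguments, so that the product of `d₁` and `d₂` is `d₁.trans d₂`. -/

variable {r : ℕ}

/-- The domain of a partial permutation. -/
def dom (d : Fin r ≃. Fin r) : Finset (Fin r) := Finset.univ.filter fun x => (d x).isSome

/-- The image of a partial permutation. -/
def im (d : Fin r ≃. Fin r) : Finset (Fin r) := dom d.symm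

/-- The rank of a partial permutation: the number of its edges. -/
def rank (d : Fin r ≃. Fin r) : ℕ := (dom d).card

theorem mem_dom {d : Fin r ≃. Fin r} {x : Fin r} : x ∈ dom d ↔ ∃ y, d x = some y := by
  simp [dom, Option.isSome_iff_exists]

theorem mem_im {d : Fin r ≃. Fin r} {y : Fin r} : y ∈ im d ↔ ∃ x, d x = some y := by
  simp [im, mem_dom, PEquiv.eq_some_iff]

/-- A partial permutation as a bijection of its domain with its image. -/
def domEquivIm (d : Fin r ≃. Fin r) : dom d ≃ im d where
  toFun x := ⟨(d x).get (by simpa [dom] using x.2), mem_im.2 ⟨x, by simp⟩⟩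
  invFun y := ⟨(d.symm y).get (by simpa [im, dom] using y.2),
    mem_dom.2 ⟨y, by rw [← PEquiv.eq_some_iff]; simp⟩⟩
  left_inv x := by
    apply Subtype.ext
    apply Option.some_injective
    simp [PEquiv.eq_some_iff]
  right_inv y := by
    apply Subtype.ext
    apply Option.some_injective
    simp [← PEquiv.eq_some_iff]

theorem card_im (d : Fin r ≃. Fin r) : (im d).card = rank d := by
  simpa [rank] using (Fintype.card_congr (domEquivIm d)).symm

theorem rank_lt (d : Fin r ≃. Fin r) : rank d < r + 1 :=
  Nat.lt_succ_of_le (by simpa [rank] using Finset.card_le_univ (dom d))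

/-- The underlying permutation of a partial permutation `d` of rank `k`: it sends `i` to `j` if `d`
sends the `i`-th element of its domain to the `j`-th element of its image. -/
def perm (d : Fin r ≃. Fin r) {k : ℕ} (h : rank d = k) : Equiv.Perm (Fin k) :=
  ((dom d).orderIsoOfFin h).toEquiv.trans
    ((domEquivIm d).trans ((im d).orderIsoOfFin ((card_im d).trans h)).symm.toEquiv)

/-- The restriction of `a` to the preimage of `u`. -/
def restr (a : Fin r ≃. Fin r) (u : Finset (Fin r)) : Fin r ≃. Fin r :=
  a.trans (PEquiv.ofSet (u : Set (Fin r)))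

theorem rank_restr {a : Fin r ≃. Fin r} {u : Finset (Fin r)} (h : u ⊆ im a) :
    rank (restr a u) = u.card := by
  rw [← card_im]
  congr 1
  ext y
  rw [mem_im]
  constructor
  · rintro ⟨x, hx⟩
    obtain ⟨b, -, hb⟩ := (PEquiv.trans_eq_some _ _ _ _).1 hx
    obtain ⟨rfl, hb⟩ := PEquiv.ofSet_eq_some_iff.1 hb
    simpa using hb
  · intro hy
    obtain ⟨x, hx⟩ := mem_im.1 (h hy)
    exact ⟨x, (PEquiv.trans_eq_some _ _ _ _).2 ⟨y, hx, PEquiv.ofSet_eq_some_self_iff.2 hy⟩⟩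

/-- The number of components of the diagram of `d₁` above `d₂` that lie in the (identified) middle
rows: the nodes there that are isolated both in `d₁` and in `d₂`. -/
def loops (d₁ d₂ : Fin r ≃. Fin r) : ℕ :=
  (Finset.univ.filter fun m => d₁.symm m = none ∧ d₂ m = none).card

theorem loops_add (d₁ d₂ d₃ : Fin r ≃. Fin r) :
    loops d₁ d₂ + loops (d₁.trans d₂) d₃ = loops d₂ d₃ + loops d₁ (d₂.trans d₃) := by
  classical
  have h1 : loops d₁ (d₂.trans d₃) = loops d₁ d₂ + (Finset.univ.filter fun m =>
      d₁.symm m = none ∧ ∃ y, d₂ m = some y ∧ d₃ y = none).card := by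
    rw [loops, loops, ← Finset.card_union_of_disjoint]
    · congr 1
      ext m
      rcases h : d₂ m with _ | y <;> simp [PEquiv.trans, h]
    · rw [Finset.disjoint_left]
      intro m hm hm'
      obtain ⟨-, y, hy, -⟩ := (Finset.mem_filter.1 hm').2
      simp [hy] at hm
  have h2 : loops (d₁.trans d₂) d₃ = loops d₂ d₃ + (Finset.univ.filter fun y =>
      (∃ m, d₂.symm y = some m ∧ d₁.symm m = none) ∧ d₃ y = none).card := by
    rw [loops, loops, ← Finset.card_union_of_disjoint]
    · congr 1
      ext y
      rw [Finset.mem_filter, PEquiv.symm_trans_rev]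
      rcases h : d₂.symm y with _ | m <;> simp [PEquiv.trans, h]
    · rw [Finset.disjoint_left]
      intro y hy hy'
      obtain ⟨⟨m, hm, -⟩, -⟩ := (Finset.mem_filter.1 hy').2
      simp [hm] at hy
  have h3 : (Finset.univ.filter fun m =>
      d₁.symm m = none ∧ ∃ y, d₂ m = some y ∧ d₃ y = none).card = (Finset.univ.filter fun y =>
      (∃ m, d₂.symm y = some m ∧ d₁.symm m = none) ∧ d₃ y = none).card := by
    refine Finset.card_bij (fun m hm => (d₂ m).get (by
      obtain ⟨-, y, hy, -⟩ := (Finset.mem_filter.1 hm).2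
      simp [hy])) ?_ ?_ ?_
    · intro m hm
      obtain ⟨h, y, hy, h'⟩ := (Finset.mem_filter.1 hm).2
      simp only [hy, Option.get_some, Finset.mem_filter, Finset.mem_univ, true_and]
      exact ⟨⟨m, (PEquiv.eq_some_iff _).2 hy, h⟩, h'⟩
    · intro m hm m' hm' h
      obtain ⟨-, y, hy, -⟩ := (Finset.mem_filter.1 hm).2
      obtain ⟨-, y', hy', -⟩ := (Finset.mem_filter.1 hm').2
      simp only [hy, hy', Option.get_some] at h
      subst h
      have e1 := (PEquiv.eq_some_iff d₂).2 hy
      have e2 := (PEquiv.eq_some_iff d₂).2 hy'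
      exact Option.some_injective _ (e1.symm.trans e2)
    · intro y hy
      obtain ⟨⟨m, hm, h⟩, h'⟩ := (Finset.mem_filter.1 hy).2
      have hm' := (PEquiv.eq_some_iff d₂).1 hm
      exact ⟨m, Finset.mem_filter.2 ⟨Finset.mem_univ _, h, y, hm', h'⟩, by simp [hm']⟩
  omega

theorem loops_refl_left (d : Fin r ≃. Fin r) : loops (PEquiv.refl _) d = 0 := by
  simp [loops]

theorem loops_refl_right (d : Fin r ≃. Fin r) : loops d (PEquiv.refl _) = 0 := by
  simp [loops]

/-! ### The algebra of partial permutations -/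

/-- The algebra of partial permutations with parameter `z`: its basis is the set of partial
permutations of `{1, …, r}`, and `d₁ d₂ = z ^ N (d₁ ∘ d₂)` with `N` the number of components omitted
from the middle rows. -/
def PP (r : ℕ) (_ : ℂ) : Type := (Fin r ≃. Fin r) →₀ ℂ

namespace PP

variable (r) (z : ℂ)

instance instAddCommGroup : AddCommGroup (PP r z) := inferInstanceAs (AddCommGroup ((Fin r ≃. Fin r) →₀ ℂ))

instance : Module ℂ (PP r z) := inferInstanceAs (Module ℂ ((Fin r ≃. Fin r) →₀ ℂ))

/-- The diagram basis. -/
def basis : Module.Basis (Fin r ≃. Fin r) ℂ (PP r z) :=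
  Module.Basis.ofRepr (LinearEquiv.refl ℂ ((Fin r ≃. Fin r) →₀ ℂ))

/-- The bilinear product. -/
def mulLin : PP r z →ₗ[ℂ] PP r z →ₗ[ℂ] PP r z :=
  (basis r z).constr ℂ fun d₁ => (basis r z).constr ℂ fun d₂ =>
    z ^ loops d₁ d₂ • basis r z (d₁.trans d₂)

variable {r z} in
theorem mulLin_basis (d₁ d₂ : Fin r ≃. Fin r) : mulLin r z (basis r z d₁) (basis r z d₂) =
    z ^ loops d₁ d₂ • basis r z (d₁.trans d₂) := by
  simp [mulLin, Module.Basis.constr_basis]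

theorem mulLin_assoc (a b c : PP r z) :
    mulLin r z (mulLin r z a b) c = mulLin r z a (mulLin r z b c) := by
  have h : (mulLin r z).compr₂ (mulLin r z) =
      ((LinearMap.llcomp ℂ (PP r z) (PP r z) (PP r z)).flip.comp (mulLin r z)).flip.comp
        (mulLin r z) := by
    refine (basis r z).ext fun d₁ => (basis r z).ext fun d₂ => (basis r z).ext fun d₃ => ?_
    simp [mulLin_basis, smul_smul, ← pow_add, loops_add, PEquiv.trans_assoc]
  exact LinearMap.congr_fun (LinearMap.congr_fun (LinearMap.congr_fun h a) b) c

theorem one_mulLin (a : PP r z) : mulLin r z (basis r z (PEquiv.refl _)) a = a := by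
  have h : mulLin r z (basis r z (PEquiv.refl _)) = LinearMap.id :=
    (basis r z).ext fun d => by simp [mulLin_basis, loops_refl_left]
  rw [h, LinearMap.id_apply]

theorem mulLin_one (a : PP r z) : mulLin r z a (basis r z (PEquiv.refl _)) = a := by
  have h : (mulLin r z).flip (basis r z (PEquiv.refl _)) = LinearMap.id :=
    (basis r z).ext fun d => by simp [mulLin_basis, loops_refl_right]
  rw [← LinearMap.flip_apply, h, LinearMap.id_apply]

instance : Ring (PP r z) where
  __ := instAddCommGroup r z
  mul a b := mulLin r z a b
  one := basis r z (PEquiv.refl _)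
  mul_assoc := mulLin_assoc r z
  one_mul := one_mulLin r z
  mul_one := mulLin_one r z
  left_distrib a b c := (mulLin r z a).map_add b c
  right_distrib a b c := (mulLin r z).map_add₂ a b c
  zero_mul a := (mulLin r z).map_zero₂ a
  mul_zero a := (mulLin r z a).map_zero

instance : Algebra ℂ (PP r z) :=
  Algebra.ofModule (fun c a b => (mulLin r z).map_smul₂ c a b)
    (fun c a b => (mulLin r z a).map_smul c b)

/-- The anti-involution of the algebra of partial permutations: diagrams are flipped upside
down. -/
def flip : PP r z →ₗ[ℂ] PP r z := (basis r z).constr ℂ fun d => basis r z d.symm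

end PP

/-! ### The layers -/

/-- The algebra `B(k)`: the group algebra of the symmetric group on `k` letters, in which
permutations act on the right of their arguments, so that the product `v w` is `v` followed by
`w`. -/
abbrev SymAlg (k : ℕ) : Type := MonoidAlgebra ℂ (Equiv.Perm (Fin k))ᵐᵒᵖ

/-- A permutation as an element of `B(k)`. -/
def ofPerm {k : ℕ} (w : Equiv.Perm (Fin k)) : SymAlg k := MonoidAlgebra.single (MulOpposite.op w) 1

/-- The anti-involution of `B(k)` that inverts permutations. -/
def invol (k : ℕ) : SymAlg k →ₗ[ℂ] SymAlg k :=
  MonoidAlgebra.mapDomainLinearMap ℂ ℂ fun w => w⁻¹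

/-- The set of subsets of `{1, …, r}` with `k` elements, the basis of `U(k)`. -/
abbrev KSubset (r k : ℕ) : Type := {u : Finset (Fin r) // u.card = k}

/-- `φ_k(a, u)` is `z ^ (r - rank a)` times the preimage of `u` under `a` if `u` lies in the image
of `a`, and `0` otherwise. -/
def phi (z : ℂ) (k : ℕ) (a : Fin r ≃. Fin r) (u : KSubset r k) : KSubset r k →₀ ℂ :=
  if h : u.1 ⊆ im a then
    z ^ (r - rank a) • Finsupp.single ⟨dom (restr a u.1), (rank_restr h).trans u.2⟩ 1
  else 0

/-- `θ_k(a, u)` is the underlying permutation of the restriction of `a` to the preimage of `u` if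
`u` lies in the image of `a`, and `0` otherwise. -/
def theta (k : ℕ) (a : Fin r ≃. Fin r) (u : KSubset r k) : SymAlg k :=
  if h : u.1 ⊆ im a then ofPerm (perm (restr a u.1) ((rank_restr h).trans u.2)) else 0

/-- The `B(k)`-valued bilinear form on `U(k)` with `ψ_k(y, u) = z ^ (r - k)` if `y = u` and `0`
otherwise, for `y` and `u` in the basis. -/
def psi (r : ℕ) (z : ℂ) (k : ℕ) : (KSubset r k →₀ ℂ) →ₗ[ℂ] (KSubset r k →₀ ℂ) →ₗ[ℂ] SymAlg k :=
  Finsupp.linearCombination ℂ fun y => Finsupp.linearCombination ℂ fun u =>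
    if y = u then z ^ (r - k) • (1 : SymAlg k) else 0

/-- The set `Λ` of the pairs of a `k ≤ r` and a partition of `k`, ordered first by `k`. -/
abbrev Lam (r : ℕ) : Type := _root_.Lex (Σ k : Fin (r + 1), Nat.Partition k)

/-! ### Specht modules -/

/-- The parts of a partition, in decreasing order. -/
def parts {k : ℕ} (μ : Nat.Partition k) : List ℕ := μ.parts.sort (· ≥ ·)

/-- The boxes of the diagram of a partition: pairs of a row and a column. -/
abbrev Box {k : ℕ} (μ : Nat.Partition k) : Type := Σ i : Fin (parts μ).length, Fin ((parts μ).get i)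

/-- A tableau of shape `μ`: a placement of the numbers `1, …, k` in the boxes. -/
abbrev Tableau {k : ℕ} (μ : Nat.Partition k) : Type := Fin k ≃ Box μ

theorem nonempty_tableau {k : ℕ} (μ : Nat.Partition k) : Nonempty (Tableau μ) := by
  refine ⟨Fintype.equivOfCardEq ?_⟩
  rw [Fintype.card_fin, Fintype.card_sigma]
  simp only [Fintype.card_fin]
  rw [← List.sum_ofFn, List.ofFn_get, ← Multiset.sum_coe, parts, Multiset.sort_eq, μ.parts_sum]

variable {k : ℕ} {μ : Nat.Partition k} (T : Tableau μ)

/-- The row symmetrizer: the sum of the permutations that preserve the rows of `T`. -/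
def rowSum : SymAlg k :=
  ∑ w : Equiv.Perm (Fin k) with ∀ i, (T (w i)).1 = (T i).1, ofPerm w

/-- The column antisymmetrizer: the signed sum of the permutations that preserve the columns
of `T`. -/
def colSum : SymAlg k :=
  ∑ w : Equiv.Perm (Fin k) with ∀ i, ((T (w i)).2 : ℕ) = (T i).2,
    ((Equiv.Perm.sign w : ℤ) : ℂ) • ofPerm w

/-- The Specht module of shape `μ`, as the left ideal that a Young symmetrizer generates. -/
def specht : Submodule (SymAlg k) (SymAlg k) := Submodule.span (SymAlg k) {colSum T * rowSum T}

end PartialPerm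

end

open PartialPerm

noncomputable section

namespace PartialPerm

/-! ### Cellular algebras over a field -/

/-! Let `d` have domain `u` and image `v`, with `|u| = k`, and multiply it on the left by `a`. If `u
⊆ im a`, the composite has as domain the preimage of `u`, still has image `v`, and its permutation
is that of the restricted `a` followed by that of `d`; exactly the `r - rank a` points outside `im
a` are omitted. If `u ⊄ im a`, the rank drops. This is the inflation rule (`basis_mul_layer`). Cell
bases of the `B(k)` inserted in the middle factor then give a cell basis of `A` (`inflate`): errors
fall either into a lower layer or into a lower cell of the same `B(k)`, whence the lexicographic
order.

Semisimplicity rests on the Graham-Lehrer form. If the forms on all cell modules are nondegenerate,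
then each nonzero cell module is simple, distinct ones are not isomorphic, and `A` embeds in a
finite product of them, so that they exhaust the simple modules. Conversely, semisimplicity forces
nondegeneracy for every cell datum (`nondegenerate_of_isSemisimpleRing`). By Maschke this applies to
any cell datum of `ℂS_k`; the inflated form is an orthogonal sum, over the `k`-subsets, of copies of
the form of `B(k)` scaled by `z ^ (r - k)` (`inflate_form`), hence nondegenerate for `z ≠ 0`.

The Specht datum of `ℂS_k` consists of the products `s * t^*`, with `s`, `t` in a basis of one
Specht module. Young symmetrizers of different shapes are orthogonal (`young_orthogonal`, by
dominance of shapes), which together with positivity of the trace form on real elements gives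
independence. They span because as many independent central elements as there are partitions must
fill the class functions, which contain `1`. This datum also shows that the index sets of any other
datum indexed by partitions are nonempty. -/

theorem exists_mul_mul_eq_self {A : Type*} [Ring A] [IsSemisimpleRing A] (x : A) :
    ∃ y, x * y * x = x := by
  -- The left ideal of `x` has an idempotent generator `e = y * x`, and `x = c * e` gives `x * e =
  -- x`.
  obtain ⟨e, he, h⟩ := IsSemisimpleRing.ideal_eq_span_idempotent (Ideal.span {x})
  obtain ⟨y, hy⟩ := Ideal.mem_span_singleton'.1 (h ▸ Ideal.mem_span_singleton_self e)
  obtain ⟨c, hc⟩ := Ideal.mem_span_singleton'.1 (h ▸ Ideal.mem_span_singleton_self x)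
  refine ⟨y, ?_⟩
  rw [mul_assoc, hy, ← hc, mul_assoc, he.eq]

namespace CellDatum

/-! ### The Graham-Lehrer form over a commutative ring -/

section Ring

variable {K A : Type*} [CommRing K] [Ring A] [Algebra K A] {s : A →ₗ[K] A} {Λ : Type*}
  [PartialOrder Λ] {M : Λ → Type*} [∀ l, Fintype (M l)] (D : CellDatum s Λ M)

/-- The structure constants of a cell datum, as a linear map. -/
def rLin (l : Λ) : A →ₗ[K] Matrix (M l) (M l) K where
  toFun := D.r l
  map_add' := (D.rep l).map_add
  map_smul' c a := by
    ext S' S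
    simp [D.r_eq l _ S' S S]

theorem rLin_apply (l : Λ) (a : A) : D.rLin l a = D.r l a := rfl

theorem smul_apply (l : Λ) (a : A) (v : D.CellModule l) (S : M l) :
    (a • v) S = ∑ U, D.r l a S U * v U := rfl

theorem smul_vec (l : Λ) (a : A) (S S' : M l) : (a • D.vec l S) S' = D.r l a S' S := by
  classical
  rw [smul_apply, Finset.sum_eq_single S]
  · simp [vec]
  · intro U _ hU
    simp [vec, hU]
  · simp

instance (l : Λ) : IsScalarTower K A (D.CellModule l) where
  smul_assoc c a v := by
    funext S
    have h : D.r l (c • a) = c • D.r l a := (D.rLin l).map_smul c a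
    change ((c • a) • v) S = c • (a • v) S
    simp [smul_apply, h, Finset.mul_sum, mul_assoc]

theorem repr_star (x : A) (l : Λ) (S T : M l) :
    D.C.repr (s x) ⟨l, S, T⟩ = D.C.repr x ⟨l, T, S⟩ := by
  classical
  have h : D.C.coord ⟨l, S, T⟩ ∘ₗ s = D.C.coord ⟨l, T, S⟩ := by
    refine D.C.ext ?_
    rintro ⟨m, X, Y⟩
    rw [LinearMap.comp_apply, D.star_C]
    simp only [Module.Basis.coord_apply, Module.Basis.repr_self, Finsupp.single_apply]
    congr 1
    apply propext
    constructor <;> intro h <;> cases h <;> rfl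
  exact LinearMap.congr_fun h x

/-- The Graham--Lehrer form on a cell module, in the basis `M l`. -/
def form (l : Λ) (T U : M l) : K := D.r l (D.C ⟨l, T, T⟩) T U

theorem repr_mul_C (l : Λ) (a : A) (S S' T T' : M l) [Decidable (T' = T)] :
    D.C.repr (a * D.C ⟨l, S, T⟩) ⟨l, S', T'⟩ = if T' = T then D.r l a S' S else 0 := by
  classical
  have h := D.repr_lower (D.mul_C l a S T) S' T'
  rw [map_sub, Finsupp.sub_apply, sub_eq_zero] at h
  rw [h]
  split_ifs with hT
  · subst hT
    simp [Finsupp.single_apply]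
  · have hT' : T ≠ T' := fun h => hT h.symm
    simp [hT']

/-- Both sides are one coefficient of the product of the cell elements of `(S, T)` and `(U, V)`:
read off directly on the left, and after applying `s` on the right. -/
theorem r_C_aux (l : Λ) (S T S' U V V' : M l) [DecidableEq (M l)] :
    (if V' = V then D.r l (D.C ⟨l, S, T⟩) S' U else 0) =
      if S' = S then D.r l (D.C ⟨l, V, U⟩) V' T else 0 := by
  rw [← D.repr_mul_C, ← D.repr_mul_C, ← D.repr_star, D.anti.1, D.star_C, D.star_C]

/-- A cell element therefore acts on its own cell module with rank at most one, through the form. -/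
theorem r_C (l : Λ) (S T S' U : M l) [Decidable (S' = S)] :
    D.r l (D.C ⟨l, S, T⟩) S' U = if S' = S then D.form l T U else 0 := by
  classical
  have h1 := D.r_C_aux l S T S' U U U
  have h2 := D.r_C_aux l T T T U U U
  simp only [if_true] at h1 h2
  rw [h1, form, h2]
  congr

theorem form_comm (l : Λ) (T U : M l) : D.form l T U = D.form l U T := by
  classical
  simpa [form] using D.r_C_aux l T T T U U U

theorem C_smul_apply (l : Λ) (S T S' : M l) [Decidable (S' = S)] (v : D.CellModule l) :
    (D.C ⟨l, S, T⟩ • v) S' = if S' = S then ∑ U, D.form l T U * v U else 0 := by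
  rw [smul_apply]
  simp_rw [r_C]
  split_ifs with h <;> simp

/-- The involution turns right multiplication into left multiplication, which never leaves the span
of the cells `≤ m`. Consequently the elements of cell `m` kill the cell module of `l` unless `l ≤
m`. -/
theorem repr_C_mul_of_not_le (l m : Λ) (h : ¬ l ≤ m) (S T : M m) (a : A) (X Y : M l) :
    D.C.repr (D.C ⟨m, S, T⟩ * a) ⟨l, X, Y⟩ = 0 := by
  classical
  rw [← D.repr_star, D.anti.1, D.star_C]
  have key : D.lower m ≤ LinearMap.ker (D.C.coord ⟨l, Y, X⟩) := by
    refine Submodule.span_le.2 ?_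
    rintro _ ⟨n, hn, X', Y', rfl⟩
    have hne : (⟨n, X', Y'⟩ : Σ l, M l × M l) ≠ ⟨l, Y, X⟩ := by
      intro h'
      obtain rfl : n = l := congrArg Sigma.fst h'
      exact h hn.le
    simp [Finsupp.single_eq_of_ne hne.symm]
  have h1 := key (D.mul_C m (s a) T S)
  rw [LinearMap.mem_ker, map_sub, sub_eq_zero] at h1
  rw [← Module.Basis.coord_apply, h1, map_sum]
  refine Finset.sum_eq_zero fun T' _ => ?_
  have hne : (⟨m, T', S⟩ : Σ l, M l × M l) ≠ ⟨l, Y, X⟩ := by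
    intro h'
    exact h (congrArg Sigma.fst h').ge
  simp [Finsupp.single_eq_of_ne hne.symm]

theorem r_C_of_not_le {l m : Λ} (h : ¬ l ≤ m) (S T : M m) : D.r l (D.C ⟨m, S, T⟩) = 0 := by
  ext S' U
  rw [D.r_eq l _ S' U U, D.repr_C_mul_of_not_le l m h]
  rfl

theorem r_star_lower {l : Λ} {x : A} (hx : x ∈ D.lower l) : D.r l (s x) = 0 := by
  have key : D.lower l ≤ LinearMap.ker (D.rLin l ∘ₗ s) := by
    refine Submodule.span_le.2 ?_
    rintro _ ⟨n, hn, X', Y', rfl⟩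
    simp only [SetLike.mem_coe, LinearMap.mem_ker, LinearMap.comp_apply, D.star_C]
    exact D.r_C_of_not_le hn.not_ge _ _
  exact key hx

/-- Nondegeneracy of the form on a cell module. -/
def Nondegenerate (l : Λ) : Prop :=
  ∀ v : M l → K, (∀ T, ∑ U, D.form l T U * v U = 0) → v = 0

/-- The radical of the form is a submodule because `a` and `s a` are adjoint. -/
theorem form_smul_eq_zero {l : Λ} {v : D.CellModule l} (hv : ∀ T, ∑ U, D.form l T U * v U = 0)
    (a : A) (T : M l) : ∑ U, D.form l T U * (a • v) U = 0 := by
  classical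
  have h1 := D.C_smul_apply l T T T (a • v)
  rw [if_pos rfl] at h1
  rw [← h1, ← mul_smul, smul_apply]
  -- Adjointness: apply `s` to the expansion of `s a * C_{T,T}`; the lower terms act as zero on this
  -- cell module.
  have h2 : D.r l (D.C ⟨l, T, T⟩ * a) = ∑ T', D.r l (s a) T' T • D.r l (D.C ⟨l, T, T'⟩) := by
    have h3 := D.r_star_lower (D.mul_C l (s a) T T)
    rw [map_sub, D.anti.1, D.star_C, D.anti.2, ← rLin_apply, map_sub, sub_eq_zero, map_sum,
      map_sum] at h3
    simpa only [rLin_apply, map_smul, D.star_C] using h3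
  have h4 : ∀ U, D.r l (D.C ⟨l, T, T⟩ * a) T U = ∑ T', D.r l (s a) T' T * D.form l T' U := by
    intro U
    rw [h2, Matrix.sum_apply]
    simp [r_C]
  simp_rw [h4, Finset.sum_mul, mul_assoc]
  rw [Finset.sum_comm]
  simp_rw [← Finset.mul_sum, hv]
  simp

/-- Put a radical vector `v` into one column of the cell: `x = ∑ v S • C_{S,S₀}`. By regularity `x =
x * y * x`, so the coefficient `v S₀` of `x` is also the `S₀` coordinate of `x • (y • v)`. But `x`
acts through the form, and `y • v` is again radical, so this coordinate is zero. -/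
theorem nondegenerate_of_isSemisimpleRing [IsDomain K] [IsSemisimpleRing A] (l : Λ) :
    D.Nondegenerate l := by
  classical
  intro v hv
  by_contra hne
  obtain ⟨S₀, hS₀⟩ := Function.ne_iff.1 hne
  set x : A := ∑ S, v S • D.C ⟨l, S, S₀⟩ with hx
  have hrepr : ∀ a : A, D.C.repr (a * x) ⟨l, S₀, S₀⟩ = ∑ S, D.r l a S₀ S * v S := by
    intro a
    rw [hx, Finset.mul_sum, map_sum, Finsupp.finsetSum_apply]
    refine Finset.sum_congr rfl fun S _ => ?_
    rw [mul_smul_comm, map_smul, Finsupp.smul_apply, D.repr_mul_C, if_pos rfl, smul_eq_mul,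
      mul_comm]
  have hrx : ∀ U, D.r l x S₀ U = v S₀ * D.form l S₀ U := by
    intro U
    rw [← rLin_apply, hx, map_sum, Matrix.sum_apply]
    simp [rLin_apply, r_C]
  obtain ⟨y, hy⟩ := exists_mul_mul_eq_self x
  let w : D.CellModule l := v
  have h1 := hrepr (x * y)
  rw [hy] at h1
  have h2 : D.C.repr x ⟨l, S₀, S₀⟩ = v S₀ := by
    rw [hx, map_sum, Finsupp.finsetSum_apply]
    simp [Finsupp.single_apply]
  have h3 : ∑ S, D.r l (x * y) S₀ S * v S = ((x * y) • w) S₀ := rfl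
  rw [h2, h3, mul_smul, smul_apply] at h1
  have h4 := D.form_smul_eq_zero (v := w) hv y S₀
  simp_rw [hrx, mul_assoc] at h1
  rw [← Finset.mul_sum, h4, mul_zero] at h1
  exact hS₀ h1

end Ring

/-! ### Simple cell modules over a field -/

variable {K A : Type*} [Field K] [Ring A] [Algebra K A] {s : A →ₗ[K] A} {Λ : Type*}
  [PartialOrder Λ] {M : Λ → Type*} [∀ l, Fintype (M l)] (D : CellDatum s Λ M)

theorem isSimpleModule_cellModule {l : Λ} [Nonempty (M l)] (h : D.Nondegenerate l) :
    IsSimpleModule A (D.CellModule l) := by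
  classical
  have : Nontrivial (D.CellModule l) := inferInstanceAs (Nontrivial (M l → K))
  refine isSimpleModule_iff_toSpanSingleton_surjective.2 ⟨this, fun v hv w => ?_⟩
  have hT : ∃ T, ∑ U, D.form l T U * v U ≠ 0 := by
    by_contra! hc
    exact hv (h v hc)
  obtain ⟨T, hT⟩ := hT
  -- `C_{S,T}` sends `v` to the basis vector of `S` times the form of `T` with `v`, so this element
  -- sends `v` to `w`.
  refine ⟨∑ S, (w S / ∑ U, D.form l T U * v U) • D.C ⟨l, S, T⟩, ?_⟩
  rw [LinearMap.toSpanSingleton_apply, Finset.sum_smul]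
  funext S'
  refine (Finset.sum_apply S' Finset.univ _).trans ?_
  have h1 : ∀ S, (((w S / ∑ U, D.form l T U * v U) • D.C ⟨l, S, T⟩) • v) S' =
      (w S / ∑ U, D.form l T U * v U) * (D.C ⟨l, S, T⟩ • v) S' := by
    intro S
    rw [smul_assoc]
    rfl
  simp_rw [h1, C_smul_apply]
  simp only [Finset.sum_ite_eq, Finset.mem_univ, if_true, mul_ite, mul_zero]
  exact div_mul_cancel₀ _ hT

/-- If `m ≤ l` fails, the elements of cell `l` kill the cell module of `m`, hence also the
isomorphic one of `l`; every basis vector of the latter is then radical. -/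
theorem le_of_linearEquiv {l m : Λ} [Nonempty (M l)] (h : D.Nondegenerate l)
    (f : D.CellModule l ≃ₗ[A] D.CellModule m) : m ≤ l := by
  classical
  by_contra hml
  obtain ⟨S⟩ := ‹Nonempty (M l)›
  have hv : (Pi.single S 1 : M l → K) ≠ 0 := by simp
  apply hv
  refine h _ fun T => ?_
  have h1 : D.C ⟨l, T, T⟩ • D.vec l S = 0 := by
    apply f.injective
    rw [map_smul, map_zero]
    funext X
    rw [smul_apply, D.r_C_of_not_le hml]
    exact Finset.sum_eq_zero fun U _ => zero_mul _
  have h2 := D.C_smul_apply l T T T (D.vec l S)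
  rw [h1, if_pos rfl] at h2
  exact h2.symm

theorem eq_of_linearEquiv {l m : Λ} [Nonempty (M l)] [Nonempty (M m)] (hl : D.Nondegenerate l)
    (hm : D.Nondegenerate m) (f : D.CellModule l ≃ₗ[A] D.CellModule m) : l = m :=
  le_antisymm (D.le_of_linearEquiv hm f.symm) (D.le_of_linearEquiv hl f)

/-- The regular module, mapped to the product of the cell modules. -/
def toCellModules : A →ₗ[A] ∀ p : Σ l, M l, D.CellModule p.1 :=
  LinearMap.pi fun p => LinearMap.toSpanSingleton A _ (D.vec p.1 p.2)

/-! ### Faithfulness, semisimplicity and completeness -/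

section Complete

variable [Finite Λ]

/-- Take `l` maximal among the cells in which `a` has a nonzero coefficient. On the cell module of
`l` only cells `≥ l` act, so only cell `l` contributes, and there `a` acts as its coefficient matrix
times the Gram matrix of the form. Nondegeneracy then kills the coefficients. -/
theorem eq_zero_of_forall_r_eq_zero (h : ∀ l, D.Nondegenerate l) (a : A)
    (ha : ∀ l, D.r l a = 0) : a = 0 := by
  classical
  have := Fintype.ofFinite Λ
  by_contra hne
  have hs : ((Finset.univ : Finset Λ).filter
      fun l => ∃ S T, D.C.repr a ⟨l, S, T⟩ ≠ 0).Nonempty := by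
    by_contra hc
    apply hne
    apply D.C.repr.injective
    ext ⟨l, S, T⟩
    by_contra h'
    rw [map_zero, Finsupp.zero_apply] at h'
    exact hc ⟨l, Finset.mem_filter.2 ⟨Finset.mem_univ _, S, T, h'⟩⟩
  obtain ⟨l, hl⟩ := Finset.exists_maximal hs
  obtain ⟨S, T, hST⟩ := (Finset.mem_filter.1 hl.prop).2
  apply hST
  refine congrFun (h l (fun T => D.C.repr a ⟨l, S, T⟩) fun U => ?_) T
  have h1 : D.r l a S U = 0 := by rw [ha]; rfl
  rw [← h1]
  conv_rhs => rw [← D.C.sum_repr a, ← rLin_apply, map_sum, Fintype.sum_sigma]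
  rw [Finset.sum_eq_single l]
  · rw [Matrix.sum_apply, Fintype.sum_prod_type]
    simp only [map_smul, rLin_apply, Matrix.smul_apply, r_C, smul_eq_mul]
    simp [mul_comm, D.form_comm l U]
  · intro m _ hm
    refine Finset.sum_eq_zero fun p _ => ?_
    by_cases hp : D.C.repr a ⟨m, p⟩ = 0
    · simp [hp]
    · have hlm : ¬ l ≤ m := fun hlm => hm (le_antisymm
        (hl.le_of_ge (Finset.mem_filter.2 ⟨Finset.mem_univ _, p.1, p.2, hp⟩) hlm) hlm)
      rw [map_smul, rLin_apply, D.r_C_of_not_le hlm, smul_zero]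
  · simp

theorem toCellModules_injective (h : ∀ l, D.Nondegenerate l) :
    Function.Injective D.toCellModules := by
  rw [injective_iff_map_eq_zero]
  intro a ha
  refine D.eq_zero_of_forall_r_eq_zero h a fun l => ?_
  ext S' S
  rw [← D.smul_vec]
  exact congrFun (congrFun ha ⟨l, S⟩) S'

theorem isSemisimpleRing (h : ∀ l, D.Nondegenerate l) : IsSemisimpleRing A := by
  have hl : ∀ l, IsSemisimpleModule A (D.CellModule l) := by
    intro l
    -- A cell with empty index set has the zero module, which is semisimple but not simple.
    rcases isEmpty_or_nonempty (M l) with hM | hM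
    · have : Subsingleton (D.CellModule l) := inferInstanceAs (Subsingleton (M l → K))
      exact { exists_isCompl := fun p =>
        ⟨p, IsCompl.of_eq (Subsingleton.elim _ _) (Subsingleton.elim _ _)⟩ }
    · have := D.isSimpleModule_cellModule (h l)
      infer_instance
  exact IsSemisimpleModule.of_injective _ (D.toCellModules_injective h)

/-- A simple module is isomorphic to a left ideal, which embeds in the product of cell modules;
Schur's lemma applies to a coordinate that does not vanish. -/
theorem exists_linearEquiv_cellModule (h : ∀ l, D.Nondegenerate l) (V : Type*)
    [AddCommGroup V] [Module A V] [IsSimpleModule A V] :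
    ∃ l, Nonempty (M l) ∧ Nonempty (V ≃ₗ[A] D.CellModule l) := by
  have := D.isSemisimpleRing h
  obtain ⟨I, ⟨f⟩⟩ := IsSemisimpleRing.exists_linearEquiv_ideal_of_isSimpleModule A V
  set g : V →ₗ[A] ∀ p : Σ l, M l, D.CellModule p.1 :=
    D.toCellModules ∘ₗ I.subtype ∘ₗ f.toLinearMap with hg
  have hinj : Function.Injective g :=
    (D.toCellModules_injective h).comp (I.injective_subtype.comp f.injective)
  have := IsSimpleModule.nontrivial A V
  obtain ⟨v, hv⟩ := exists_ne (0 : V)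
  obtain ⟨p, hp⟩ := Function.ne_iff.1 ((map_ne_zero_iff g hinj).2 hv)
  have : Nonempty (M p.1) := ⟨p.2⟩
  have := D.isSimpleModule_cellModule (h p.1)
  refine ⟨p.1, ⟨p.2⟩, ⟨LinearEquiv.ofBijective ((LinearMap.proj p).comp g)
    (LinearMap.bijective_of_ne_zero fun h0 => hp ?_)⟩⟩
  exact LinearMap.congr_fun h0 v

end Complete

end CellDatum

/-! ### Tableaux -/

section Tableaux

variable {k : ℕ} {μ ν : Nat.Partition k}

theorem box_ext {b b' : Box μ} (h1 : b.1 = b'.1) (h2 : (b.2 : ℕ) = b'.2) : b = b' := by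
  obtain ⟨i, j⟩ := b
  obtain ⟨i', j'⟩ := b'
  obtain rfl : i = i' := h1
  obtain rfl : j = j' := Fin.ext h2
  rfl

theorem exists_box_of_le (b : Box μ) {i : ℕ} (h : i ≤ b.1) :
    ∃ b' : Box μ, (b'.1 : ℕ) = i ∧ (b'.2 : ℕ) = b.2 := by
  obtain ⟨j, c⟩ := b
  have hi : i < (parts μ).length := lt_of_le_of_lt h j.2
  have hle : (parts μ).get j ≤ (parts μ).get ⟨i, hi⟩ := by
    rcases h.eq_or_lt with h | h
    · exact le_of_eq (congrArg _ (Fin.ext h.symm))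
    · exact List.pairwise_iff_get.1 (Multiset.pairwise_sort μ.parts (· ≥ ·)) ⟨i, hi⟩ j h
  exact ⟨⟨⟨i, hi⟩, ⟨c, lt_of_lt_of_le c.2 hle⟩⟩, rfl, rfl⟩

theorem card_row_eq (T : Tableau μ) (i : ℕ) :
    (Finset.univ.filter fun x => ((T x).1 : ℕ) = i).card = (parts μ).getD i 0 := by
  classical
  by_cases hi : i < (parts μ).length
  · rw [List.getD_eq_getElem _ _ hi]
    have e1 : {x // ((T x).1 : ℕ) = i} ≃ {b : Box μ // b.1 = ⟨i, hi⟩} :=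
      T.subtypeEquiv fun x => by rw [Fin.ext_iff]
    have e2 := e1.trans (Equiv.sigmaSubtype (⟨i, hi⟩ : Fin (parts μ).length))
    rw [← Fintype.card_subtype, Fintype.card_congr e2, Fintype.card_fin]
    rfl
  · rw [List.getD_eq_default _ _ (not_lt.1 hi), Finset.card_eq_zero,
      Finset.filter_eq_empty_iff]
    rintro x - rfl
    exact hi (T x).1.2

theorem card_row_lt_succ (T : Tableau μ) (m : ℕ) :
    (Finset.univ.filter fun x => ((T x).1 : ℕ) < m + 1).card =
      (Finset.univ.filter fun x => ((T x).1 : ℕ) < m).card + (parts μ).getD m 0 := by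
  rw [← card_row_eq T m, ← Finset.card_union_of_disjoint]
  · congr 1
    ext x
    simp only [Finset.mem_filter, Finset.mem_union, Finset.mem_univ, true_and]
    omega
  · rw [Finset.disjoint_filter]
    intro x _ h
    exact h.ne

theorem card_row_lt_eq (T T' : Tableau μ) (m : ℕ) :
    (Finset.univ.filter fun x => ((T x).1 : ℕ) < m).card =
      (Finset.univ.filter fun x => ((T' x).1 : ℕ) < m).card := by
  induction m with
  | zero => simp
  | succ m ih => rw [card_row_lt_succ, card_row_lt_succ, ih]

theorem eq_of_card_row_lt_eq (T : Tableau μ) (T' : Tableau ν)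
    (h : ∀ m, (Finset.univ.filter fun x => ((T x).1 : ℕ) < m).card =
      (Finset.univ.filter fun x => ((T' x).1 : ℕ) < m).card) : μ = ν := by
  have h1 : ∀ m, (parts μ).getD m 0 = (parts ν).getD m 0 := by
    intro m
    have h2 := h (m + 1)
    rw [card_row_lt_succ, card_row_lt_succ, h m] at h2
    omega
  -- The default `0` of `getD` marks a missing row; since parts are positive, it cannot be mistaken
  -- for a part.
  have hpos : ∀ (ρ : Nat.Partition k) (m x : ℕ), (parts ρ)[m]? = some x → 0 < x := by
    intro ρ m x hx
    exact ρ.parts_pos ((Multiset.mem_sort _).1 (List.mem_of_getElem? hx))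
  have h3 : parts μ = parts ν := by
    refine List.ext_getElem? fun m => ?_
    have h4 := h1 m
    rw [List.getD_eq_getElem?_getD, List.getD_eq_getElem?_getD] at h4
    rcases hx : (parts μ)[m]? with _ | x <;> rcases hy : (parts ν)[m]? with _ | y
    · rfl
    · have := hpos _ _ _ hy
      rw [hx, hy] at h4
      simp at h4
      omega
    · have := hpos _ _ _ hx
      rw [hx, hy] at h4
      simp at h4
      omega
    · rw [hx, hy] at h4
      simpa using h4
  apply Nat.Partition.ext
  rw [← Multiset.sort_eq μ.parts (· ≥ ·), ← Multiset.sort_eq ν.parts (· ≥ ·)]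
  exact congrArg _ h3

/-- No two numbers lie in the same row of the first tableau and in the same column of the second
one. -/
def Transverse (T : Tableau ν) (T' : Tableau μ) : Prop :=
  ∀ x y, (T x).1 = (T y).1 → ((T' x).2 : ℕ) = (T' y).2 → x = y

variable {T : Tableau ν} {T' : Tableau μ}

/-- The entries of column `c` of `T'` lie in distinct rows of `T`, so at most `m` of them are in its
first `m` rows. If the column reaches below row `m`, then `T'` attains this bound; otherwise the
right side counts the whole column. Summed over `c`, this says that the shape of `T'` dominates that
of `T`. -/
theorem Transverse.card_col_le (h : Transverse T T') (m c : ℕ) :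
    (Finset.univ.filter fun x => ((T x).1 : ℕ) < m ∧ ((T' x).2 : ℕ) = c).card ≤
      (Finset.univ.filter fun x => ((T' x).1 : ℕ) < m ∧ ((T' x).2 : ℕ) = c).card := by
  classical
  by_cases hc : ∃ x, ((T' x).2 : ℕ) = c ∧ m ≤ (T' x).1
  · obtain ⟨x, hx, hm⟩ := hc
    have h1 : (Finset.univ.filter fun x => ((T x).1 : ℕ) < m ∧ ((T' x).2 : ℕ) = c).card ≤
        (Finset.range m).card := by
      refine Finset.card_le_card_of_injOn (fun x => ((T x).1 : ℕ)) ?_ ?_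
      · intro y hy
        simpa using (Finset.mem_filter.1 hy).2.1
      · intro y hy y' hy' hyy
        have hy := (Finset.mem_filter.1 hy).2.2
        have hy' := (Finset.mem_filter.1 hy').2.2
        exact h y y' (Fin.ext hyy) (hy.trans hy'.symm)
    have h2 : Finset.range m ⊆ (Finset.univ.filter fun x =>
        ((T' x).1 : ℕ) < m ∧ ((T' x).2 : ℕ) = c).image fun x => ((T' x).1 : ℕ) := by
      intro i hi
      rw [Finset.mem_range] at hi
      obtain ⟨b, hb1, hb2⟩ := exists_box_of_le (T' x) (hi.le.trans hm)
      refine Finset.mem_image.2 ⟨T'.symm b, ?_, ?_⟩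
      · refine Finset.mem_filter.2 ⟨Finset.mem_univ _, by simp [hb1, hi], ?_⟩
        exact (congrArg (fun b : Box μ => (b.2 : ℕ)) (T'.apply_symm_apply b)).trans (hb2.trans hx)
      · simpa using hb1
    exact h1.trans ((Finset.card_le_card h2).trans Finset.card_image_le)
  · push Not at hc
    refine Finset.card_le_card fun x hx => ?_
    have hx := (Finset.mem_filter.1 hx).2.2
    exact Finset.mem_filter.2 ⟨Finset.mem_univ _, hc x hx, hx⟩

theorem card_row_lt_eq_sum (S : Tableau ν) (T' : Tableau μ) (m : ℕ) :
    (Finset.univ.filter fun x => ((S x).1 : ℕ) < m).card =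
      ∑ c ∈ Finset.univ.image fun x => ((T' x).2 : ℕ),
        (Finset.univ.filter fun x => ((S x).1 : ℕ) < m ∧ ((T' x).2 : ℕ) = c).card := by
  rw [Finset.card_eq_sum_card_fiberwise (f := fun x => ((T' x).2 : ℕ))
    (t := Finset.univ.image fun x => ((T' x).2 : ℕ)) fun x _ => by simp]
  simp only [Finset.filter_filter]

theorem Transverse.card_row_le (h : Transverse T T') (m : ℕ) :
    (Finset.univ.filter fun x => ((T x).1 : ℕ) < m).card ≤
      (Finset.univ.filter fun x => ((T' x).1 : ℕ) < m).card := by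
  rw [card_row_lt_eq_sum T T' m, card_row_lt_eq_sum T' T' m]
  exact Finset.sum_le_sum fun c _ => h.card_col_le m c

/-- Transversality both ways gives dominance both ways, and dominance is antisymmetric. -/
theorem eq_of_transverse {S S₁ : Tableau ν} {S' S₁' : Tableau μ} (h : Transverse S S')
    (h' : Transverse S₁' S₁) : μ = ν := by
  refine (eq_of_card_row_lt_eq S S' fun m => le_antisymm (h.card_row_le m) ?_).symm
  rw [card_row_lt_eq S S₁, card_row_lt_eq S' S₁']
  exact h'.card_row_le m

/-- For equal shapes the column inequalities have equal sums, hence are equalities. Differences in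
`m` show that column `c` of `T'` has as many entries in row `m` of `T` as in row `m` of `T'`, so a
box in row `m` and column `c` exists. -/
theorem Transverse.exists_box {T T' : Tableau μ} (h : Transverse T T') (x : Fin k) :
    ∃ b : Box μ, b.1 = (T x).1 ∧ (b.2 : ℕ) = (T' x).2 := by
  have h1 : ∀ m, ∀ c ∈ Finset.univ.image fun x => ((T' x).2 : ℕ),
      (Finset.univ.filter fun x => ((T x).1 : ℕ) < m ∧ ((T' x).2 : ℕ) = c).card =
      (Finset.univ.filter fun x => ((T' x).1 : ℕ) < m ∧ ((T' x).2 : ℕ) = c).card := by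
    intro m
    rw [← Finset.sum_eq_sum_iff_of_le fun c _ => h.card_col_le m c,
      ← card_row_lt_eq_sum, ← card_row_lt_eq_sum, card_row_lt_eq]
  have h2 : ∀ (S : Tableau μ) (m c : ℕ),
      (Finset.univ.filter fun x => ((S x).1 : ℕ) < m + 1 ∧ ((T' x).2 : ℕ) = c).card =
      (Finset.univ.filter fun x => ((S x).1 : ℕ) < m ∧ ((T' x).2 : ℕ) = c).card +
      (Finset.univ.filter fun x => ((S x).1 : ℕ) = m ∧ ((T' x).2 : ℕ) = c).card := by
    intro S m c
    rw [← Finset.card_union_of_disjoint]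
    · congr 1
      ext x
      simp only [Finset.mem_filter, Finset.mem_union, Finset.mem_univ, true_and]
      omega
    · rw [Finset.disjoint_filter]
      rintro x _ h ⟨h', _⟩
      omega
  set c := ((T' x).2 : ℕ) with hc
  set m := ((T x).1 : ℕ) with hm
  have hcm : c ∈ Finset.univ.image fun x => ((T' x).2 : ℕ) :=
    Finset.mem_image_of_mem _ (Finset.mem_univ x)
  have h3 := h2 T m c
  rw [h1 _ c hcm, h1 _ c hcm, h2 T'] at h3
  have h4 : 0 < (Finset.univ.filter fun x => ((T x).1 : ℕ) = m ∧ ((T' x).2 : ℕ) = c).card :=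
    Finset.card_pos.2 ⟨x, Finset.mem_filter.2 ⟨Finset.mem_univ _, hm.symm, hc.symm⟩⟩
  obtain ⟨y, hy⟩ := Finset.card_pos.1 (show 0 < (Finset.univ.filter fun x =>
    ((T' x).1 : ℕ) = m ∧ ((T' x).2 : ℕ) = c).card by omega)
  obtain ⟨-, hy1, hy2⟩ := Finset.mem_filter.1 hy
  exact ⟨T' y, Fin.ext hy1, hy2⟩

/-- If `T` and `w⁻¹ T` are transverse, then `w` is a product of a row permutation and a column
permutation of `T`. -/
theorem exists_factorization {T : Tableau μ} {w : Equiv.Perm (Fin k)}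
    (h : Transverse T ((w⁻¹ : Equiv.Perm (Fin k)).trans T)) :
    ∃ p q : Equiv.Perm (Fin k), (∀ i, (T (p i)).1 = (T i).1) ∧
      (∀ i, ((T (q i)).2 : ℕ) = (T i).2) ∧ w = p * q := by
  -- Each number gets the box with its row in `T` and its column in `w⁻¹ T`. By transversality this
  -- is a tableau `B`, equal to `T` after a row permutation `p`; then `p * w` preserves the columns
  -- of `T`.
  choose b hb1 hb2 using h.exists_box
  have hinj : Function.Injective b := by
    intro x y hxy
    refine h x y ?_ ?_
    · rw [← hb1, ← hb1, hxy]
    · rw [← hb2, ← hb2, hxy]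
  have hbij : Function.Bijective b := by
    rw [Fintype.bijective_iff_injective_and_card]
    exact ⟨hinj, Fintype.card_congr T⟩
  let B : Tableau μ := Equiv.ofBijective b hbij
  have hB : ∀ x, B x = b x := fun x => rfl
  let p : Equiv.Perm (Fin k) := B.trans T.symm
  have hp : ∀ x, T (p x) = b x := fun x => by simp [p, hB]
  refine ⟨p⁻¹, p * w, fun i => ?_, fun i => ?_, by simp⟩
  · have h1 := hb1 (p⁻¹ i)
    rw [← hp] at h1
    simpa using h1.symm
  · have h1 := hb2 (w i)
    rw [← hp] at h1
    exact h1.trans (congrArg (fun x => ((T x).2 : ℕ)) (w.symm_apply_apply i))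

end Tableaux

/-! ### The group algebra of the symmetric group -/

section SymAlg

variable {k : ℕ}

/-- The basis of permutations of `B(k)`. -/
def permBasis (k : ℕ) : Module.Basis (Equiv.Perm (Fin k)) ℂ (SymAlg k) :=
  Module.Basis.ofRepr ((MonoidAlgebra.coeffLinearEquiv ℂ).trans
    (Finsupp.domLCongr MulOpposite.opEquiv.symm))

@[simp]
theorem permBasis_apply (w : Equiv.Perm (Fin k)) : permBasis k w = ofPerm w := by
  apply (permBasis k).repr.injective
  rw [Module.Basis.repr_self]
  simp [permBasis, ofPerm]

theorem permBasis_repr_apply (x : SymAlg k) (w : Equiv.Perm (Fin k)) :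
    (permBasis k).repr x w = x.coeff (MulOpposite.op w) := by
  simp [permBasis]

@[simp]
theorem permBasis_repr_ofPerm (w : Equiv.Perm (Fin k)) :
    (permBasis k).repr (ofPerm w) = Finsupp.single w 1 := by
  rw [← permBasis_apply, Module.Basis.repr_self]

theorem sum_repr_smul_ofPerm (x : SymAlg k) : ∑ w, (permBasis k).repr x w • ofPerm w = x := by
  simpa using (permBasis k).sum_repr x

/-- The order is reversed because permutations in `B(k)` act on the right. -/
theorem ofPerm_mul (v w : Equiv.Perm (Fin k)) : ofPerm v * ofPerm w = ofPerm (w * v) := by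
  simp [ofPerm, MonoidAlgebra.single_mul_single]

theorem ofPerm_one : ofPerm (1 : Equiv.Perm (Fin k)) = 1 := rfl

theorem ofPerm_mul_inv (w : Equiv.Perm (Fin k)) : ofPerm w * ofPerm w⁻¹ = 1 := by
  rw [ofPerm_mul, inv_mul_cancel, ofPerm_one]

theorem ofPerm_inv_mul (w : Equiv.Perm (Fin k)) : ofPerm w⁻¹ * ofPerm w = 1 := by
  rw [ofPerm_mul, mul_inv_cancel, ofPerm_one]

@[simp]
theorem invol_ofPerm (w : Equiv.Perm (Fin k)) : invol k (ofPerm w) = ofPerm w⁻¹ := by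
  simp [invol, ofPerm]

theorem linearMap_ext_ofPerm {V : Type*} [AddCommMonoid V] [Module ℂ V] {f g : SymAlg k →ₗ[ℂ] V}
    (h : ∀ w, f (ofPerm w) = g (ofPerm w)) : f = g :=
  (permBasis k).ext fun w => by simpa using h w

theorem invol_mul (x y : SymAlg k) : invol k (x * y) = invol k y * invol k x := by
  have h : (LinearMap.mul ℂ (SymAlg k)).compr₂ (invol k) =
      ((LinearMap.mul ℂ (SymAlg k)).compl₁₂ (invol k) (invol k)).flip := by
    refine linearMap_ext_ofPerm fun v => linearMap_ext_ofPerm fun w => ?_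
    simp [ofPerm_mul]
  exact LinearMap.congr_fun (LinearMap.congr_fun h x) y

theorem invol_invol (x : SymAlg k) : invol k (invol k x) = x := by
  have h : invol k ∘ₗ invol k = LinearMap.id := linearMap_ext_ofPerm fun v => by simp
  exact LinearMap.congr_fun h x

theorem isAntiInvolution_invol (k : ℕ) : IsAntiInvolution (invol k) :=
  ⟨invol_mul, invol_invol⟩

/-- The coefficient of the identity. -/
def tr (k : ℕ) : SymAlg k →ₗ[ℂ] ℂ := (permBasis k).coord 1

theorem tr_ofPerm (w : Equiv.Perm (Fin k)) [Decidable (w = 1)] :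
    tr k (ofPerm w) = if w = 1 then 1 else 0 := by
  classical
  simp [tr, Finsupp.single_apply]

theorem tr_mul_comm (x y : SymAlg k) : tr k (x * y) = tr k (y * x) := by
  classical
  have h : (LinearMap.mul ℂ (SymAlg k)).compr₂ (tr k) =
      ((LinearMap.mul ℂ (SymAlg k)).compr₂ (tr k)).flip := by
    refine linearMap_ext_ofPerm fun v => linearMap_ext_ofPerm fun w => ?_
    simp only [LinearMap.compr₂_apply, LinearMap.mul_apply', LinearMap.flip_apply, ofPerm_mul,
      tr_ofPerm, mul_eq_one_comm]
  exact LinearMap.congr_fun (LinearMap.congr_fun h x) y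

theorem tr_invol_mul_self (x : SymAlg k) :
    tr k (invol k x * x) = ∑ w, (permBasis k).repr x w * (permBasis k).repr x w := by
  classical
  conv_lhs => rw [← sum_repr_smul_ofPerm x]
  simp only [map_sum, map_smul, invol_ofPerm, Finset.sum_mul_sum, smul_mul_smul_comm, ofPerm_mul,
    tr_ofPerm, mul_inv_eq_one, smul_eq_mul]
  simp

/-- The elements of the group algebra with real coefficients. -/
def realSubring (k : ℕ) : Subring (SymAlg k) :=
  (MonoidAlgebra.mapRingHom (Equiv.Perm (Fin k))ᵐᵒᵖ (algebraMap ℝ ℂ)).range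

theorem ofPerm_mem_realSubring (w : Equiv.Perm (Fin k)) : ofPerm w ∈ realSubring k :=
  ⟨MonoidAlgebra.single (MulOpposite.op w) 1, by simp [ofPerm]⟩

/-- A sum of squares of real coefficients. The involution is `ℂ`-linear, not conjugate-linear, so
real coefficients are essential here. -/
theorem tr_invol_mul_self_ne_zero {x : SymAlg k} (hx : x ∈ realSubring k) (h : x ≠ 0) :
    tr k (invol k x * x) ≠ 0 := by
  obtain ⟨y, rfl⟩ := hx
  rw [tr_invol_mul_self]
  have h1 : ∀ w, (permBasis k).repr (MonoidAlgebra.mapRingHom (Equiv.Perm (Fin k))ᵐᵒᵖ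
      (algebraMap ℝ ℂ) y) w = (y.coeff (MulOpposite.op w) : ℂ) := by
    intro w
    rw [permBasis_repr_apply]
    simp
  simp_rw [h1]
  norm_cast
  intro h2
  apply h
  rw [Finset.sum_eq_zero_iff_of_nonneg fun w _ => mul_self_nonneg _] at h2
  apply (permBasis k).repr.injective
  ext w
  rw [h1, mul_self_eq_zero.1 (h2 w (Finset.mem_univ w))]
  simp

theorem invol_mul_self_ne_zero {x : SymAlg k} (hx : x ∈ realSubring k) (h : x ≠ 0) :
    invol k x * x ≠ 0 := fun h' => tr_invol_mul_self_ne_zero hx h (by rw [h', map_zero])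

instance isSemisimpleRing_symAlg (k : ℕ) : IsSemisimpleRing (SymAlg k) := by
  have : Finite (Equiv.Perm (Fin k))ᵐᵒᵖ := Finite.of_equiv _ MulOpposite.opEquiv
  have : NeZero (Nat.card (Equiv.Perm (Fin k))ᵐᵒᵖ : ℂ) :=
    ⟨Nat.cast_ne_zero.2 Nat.card_pos.ne'⟩
  infer_instance

end SymAlg

/-! ### Young symmetrizers -/

section Young

variable {k : ℕ} {μ ν : Nat.Partition k} (T : Tableau μ) (T' : Tableau ν)

theorem rowSum_mem_realSubring : rowSum T ∈ realSubring k :=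
  sum_mem fun w _ => ofPerm_mem_realSubring w

theorem colSum_mem_realSubring : colSum T ∈ realSubring k :=
  sum_mem fun w _ => by
    rw [Int.cast_smul_eq_zsmul]
    exact zsmul_mem (ofPerm_mem_realSubring w) _

theorem invol_rowSum : invol k (rowSum T) = rowSum T := by
  rw [rowSum, map_sum]
  refine Finset.sum_nbij' (·⁻¹) (·⁻¹) ?_ ?_ ?_ ?_ ?_
  · intro w hw
    simp only [Finset.mem_filter, Finset.mem_univ, true_and] at hw ⊢
    intro i
    rw [← hw (w⁻¹ i)]
    simp
  · intro w hw
    simp only [Finset.mem_filter, Finset.mem_univ, true_and] at hw ⊢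
    intro i
    rw [← hw (w⁻¹ i)]
    simp
  · simp
  · simp
  · simp

theorem col_inv {w : Equiv.Perm (Fin k)} (hw : ∀ i, ((T (w i)).2 : ℕ) = (T i).2) (i : Fin k) :
    ((T (w⁻¹ i)).2 : ℕ) = (T i).2 := by
  rw [← hw (w⁻¹ i)]
  exact congrArg (fun x => ((T x).2 : ℕ)) (w.apply_symm_apply i)

theorem invol_colSum : invol k (colSum T) = colSum T := by
  rw [colSum, map_sum]
  refine Finset.sum_nbij' (·⁻¹) (·⁻¹) ?_ ?_ ?_ ?_ ?_
  · intro w hw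
    simp only [Finset.mem_filter, Finset.mem_univ, true_and] at hw ⊢
    exact col_inv T hw
  · intro w hw
    simp only [Finset.mem_filter, Finset.mem_univ, true_and] at hw ⊢
    exact col_inv T hw
  · simp
  · simp
  · simp

theorem ofPerm_mul_rowSum {p : Equiv.Perm (Fin k)} (hp : ∀ i, (T (p i)).1 = (T i).1) :
    ofPerm p * rowSum T = rowSum T := by
  rw [rowSum, Finset.mul_sum]
  refine Finset.sum_nbij' (· * p) (· * p⁻¹) ?_ ?_ ?_ ?_ ?_
  · intro w hw
    simp only [Finset.mem_filter, Finset.mem_univ, true_and] at hw ⊢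
    intro i
    rw [Equiv.Perm.mul_apply, hw, hp]
  · intro w hw
    simp only [Finset.mem_filter, Finset.mem_univ, true_and] at hw ⊢
    intro i
    rw [Equiv.Perm.mul_apply, hw, ← hp]
    simp
  · simp
  · simp
  · simp [ofPerm_mul]

theorem colSum_mul_ofPerm {q : Equiv.Perm (Fin k)} (hq : ∀ i, ((T (q i)).2 : ℕ) = (T i).2) :
    colSum T * ofPerm q = ((Equiv.Perm.sign q : ℤ) : ℂ) • colSum T := by
  rw [colSum, Finset.sum_mul, Finset.smul_sum]
  refine Finset.sum_nbij' (q * ·) (q⁻¹ * ·) ?_ ?_ ?_ ?_ ?_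
  · intro w hw
    simp only [Finset.mem_filter, Finset.mem_univ, true_and] at hw ⊢
    intro i
    rw [Equiv.Perm.mul_apply, hq, hw]
  · intro w hw
    simp only [Finset.mem_filter, Finset.mem_univ, true_and] at hw ⊢
    intro i
    rw [Equiv.Perm.mul_apply, col_inv T hq, hw]
  · simp
  · simp
  · intro w _
    rw [smul_mul_assoc, ofPerm_mul, smul_smul, Equiv.Perm.sign_mul]
    congr 1
    rcases Int.units_eq_one_or (Equiv.Perm.sign q) with h | h <;> simp [h]

theorem exists_rowSum_mul_self : ∃ c : ℂ, c ≠ 0 ∧ rowSum T * rowSum T = c • rowSum T := by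
  refine ⟨((Finset.univ.filter fun w : Equiv.Perm (Fin k) =>
    ∀ i, (T (w i)).1 = (T i).1).card : ℂ), ?_, ?_⟩
  · rw [Nat.cast_ne_zero]
    exact Finset.card_ne_zero_of_mem (a := 1) (by simp)
  · conv_lhs => enter [1]; rw [rowSum]
    rw [Finset.sum_mul, Finset.sum_congr rfl fun w hw =>
      ofPerm_mul_rowSum T (Finset.mem_filter.1 hw).2, Finset.sum_const, Nat.cast_smul_eq_nsmul]

theorem exists_colSum_mul_self : ∃ c : ℂ, c ≠ 0 ∧ colSum T * colSum T = c • colSum T := by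
  refine ⟨((Finset.univ.filter fun w : Equiv.Perm (Fin k) =>
    ∀ i, ((T (w i)).2 : ℕ) = (T i).2).card : ℂ), ?_, ?_⟩
  · rw [Nat.cast_ne_zero]
    exact Finset.card_ne_zero_of_mem (a := 1) (by simp)
  · conv_lhs => enter [2]; rw [colSum]
    rw [Finset.mul_sum, Finset.sum_congr rfl fun w hw => ?_, Finset.sum_const,
      Nat.cast_smul_eq_nsmul]
    rw [mul_smul_comm, colSum_mul_ofPerm T (Finset.mem_filter.1 hw).2, smul_smul]
    rcases Int.units_eq_one_or (Equiv.Perm.sign w) with h | h <;> simp [h]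

/-- Failure of transversality yields a transposition that the row sum absorbs and that, moved past
`w`, changes the sign of the column sum; the product equals its own negative. -/
theorem colSum_mul_ofPerm_mul_rowSum {w : Equiv.Perm (Fin k)}
    (h : ¬ Transverse T ((w⁻¹ : Equiv.Perm (Fin k)).trans T')) :
    colSum T' * ofPerm w * rowSum T = 0 := by
  simp only [Transverse, not_forall] at h
  obtain ⟨x, y, hxy, hxy', hne⟩ := h
  have h1 : ofPerm (Equiv.swap x y) * rowSum T = rowSum T := by
    refine ofPerm_mul_rowSum T fun i => ?_
    rcases eq_or_ne i x with rfl | hx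
    · rw [Equiv.swap_apply_left, hxy]
    · rcases eq_or_ne i y with rfl | hy
      · rw [Equiv.swap_apply_right, hxy]
      · rw [Equiv.swap_apply_of_ne_of_ne hx hy]
  have h2 : colSum T' * ofPerm (Equiv.swap (w⁻¹ x) (w⁻¹ y)) = -colSum T' := by
    rw [colSum_mul_ofPerm T' fun i => ?_, Equiv.Perm.sign_swap fun h => hne (w⁻¹.injective h)]
    · simp
    · rcases eq_or_ne i (w⁻¹ x) with rfl | hx
      · rw [Equiv.swap_apply_left]
        exact hxy'.symm
      · rcases eq_or_ne i (w⁻¹ y) with rfl | hy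
        · rw [Equiv.swap_apply_right]
          exact hxy'
        · rw [Equiv.swap_apply_of_ne_of_ne hx hy]
  have h3 : ofPerm w * ofPerm (Equiv.swap x y) =
      ofPerm (Equiv.swap (w⁻¹ x) (w⁻¹ y)) * ofPerm w := by
    rw [ofPerm_mul, ofPerm_mul, Equiv.mul_swap_eq_swap_mul]
    simp
  have h4 : colSum T' * ofPerm w * rowSum T = -(colSum T' * ofPerm w * rowSum T) := by
    conv_lhs => rw [← h1, ← mul_assoc, mul_assoc (colSum T'), h3, ← mul_assoc, h2]
    simp
  exact (IsUnit.mk0 (2 : ℂ) two_ne_zero).smul_eq_zero.1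
    ((two_smul ℂ _).trans (add_eq_zero_iff_eq_neg.2 h4))

theorem colSum_mul_mul_rowSum_eq_zero (h : ∀ (S : Tableau μ) (S' : Tableau ν), ¬ Transverse S S')
    (x : SymAlg k) : colSum T' * x * rowSum T = 0 := by
  rw [← sum_repr_smul_ofPerm x, Finset.mul_sum, Finset.sum_mul]
  refine Finset.sum_eq_zero fun w _ => ?_
  rw [mul_smul_comm, smul_mul_assoc, colSum_mul_ofPerm_mul_rowSum T T' (h _ _), smul_zero]

theorem rowSum_mul_mul_colSum_eq_zero (h : ∀ (S : Tableau μ) (S' : Tableau ν), ¬ Transverse S S')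
    (x : SymAlg k) : rowSum T * x * colSum T' = 0 := by
  have h1 := congrArg (invol k) (colSum_mul_mul_rowSum_eq_zero T T' h (invol k x))
  rwa [invol_mul, invol_mul, invol_invol, invol_rowSum, invol_colSum, map_zero,
    ← mul_assoc] at h1

/-- It suffices to take a permutation for `x`. In the transverse case it is `p * q`, which in `B(k)`
is `q` to the left of `p`: the column sum absorbs `q` up to sign and the row sum absorbs `p`.
Otherwise the product vanishes. -/
theorem exists_colSum_mul_mul_rowSum (x : SymAlg k) :
    ∃ c : ℂ, colSum T * x * rowSum T = c • (colSum T * rowSum T) := by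
  have h : ∀ w, ∃ c : ℂ, colSum T * ofPerm w * rowSum T = c • (colSum T * rowSum T) := by
    intro w
    by_cases hw : Transverse T ((w⁻¹ : Equiv.Perm (Fin k)).trans T)
    · obtain ⟨p, q, hp, hq, rfl⟩ := exists_factorization hw
      refine ⟨((Equiv.Perm.sign q : ℤ) : ℂ), ?_⟩
      rw [← ofPerm_mul, ← mul_assoc, colSum_mul_ofPerm T hq, mul_assoc, ofPerm_mul_rowSum T hp,
        smul_mul_assoc]
    · exact ⟨0, by rw [colSum_mul_ofPerm_mul_rowSum T T hw, zero_smul]⟩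
  choose c hc using h
  refine ⟨∑ w, (permBasis k).repr x w * c w, ?_⟩
  conv_lhs => rw [← sum_repr_smul_ofPerm x, Finset.mul_sum, Finset.sum_mul]
  rw [Finset.sum_smul]
  refine Finset.sum_congr rfl fun w _ => ?_
  rw [mul_smul_comm, smul_mul_assoc, hc, smul_smul]

/-- The Young symmetrizer that generates the Specht module. -/
def young : SymAlg k := colSum T * rowSum T

/-- The row group and the column group meet only in the identity. -/
theorem tr_young : tr k (young T) = 1 := by
  classical
  rw [young, colSum, rowSum, Finset.sum_mul_sum, map_sum, Finset.sum_eq_single 1]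
  · rw [map_sum, Finset.sum_eq_single 1]
    · simp [ofPerm_mul, tr_ofPerm]
    · intro p _ hp
      simp [ofPerm_mul, tr_ofPerm, hp]
    · simp
  · intro q hq hq1
    rw [map_sum]
    refine Finset.sum_eq_zero fun p hp => ?_
    rw [smul_mul_assoc, ofPerm_mul, map_smul, tr_ofPerm, if_neg, smul_zero]
    intro hpq
    apply hq1
    rw [Finset.mem_filter] at hp hq
    ext i : 1
    apply T.injective
    refine box_ext ?_ (hq.2 i)
    rw [← hp.2 (q i), ← Equiv.Perm.mul_apply, hpq]
  · simp

theorem young_ne_zero : young T ≠ 0 := by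
  intro h
  have h1 := tr_young T
  rw [h, map_zero] at h1
  exact zero_ne_one h1

theorem young_mem_realSubring : young T ∈ realSubring k :=
  mul_mem (colSum_mem_realSubring T) (rowSum_mem_realSubring T)

theorem invol_young : invol k (young T) = rowSum T * colSum T := by
  rw [young, invol_mul, invol_rowSum, invol_colSum]

theorem exists_invol_young_mul_young :
    ∃ c : ℂ, c ≠ 0 ∧ invol k (young T) * young T = c • (rowSum T * colSum T * rowSum T) := by
  obtain ⟨c, hc, h⟩ := exists_colSum_mul_self T
  refine ⟨c, hc, ?_⟩
  rw [invol_young, young, mul_assoc, ← mul_assoc (colSum T), h]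
  simp [mul_assoc]

/-- Write `e = b a`, with `b` the column and `a` the row sum. The sandwich lemma gives `e² = c e`.
If `c = 0`, then the real self-adjoint element `x = a b a` satisfies `x^* x = c' a e² = 0`, so `x =
0` by positivity; but `e^* e` is a multiple of `x` and is nonzero. -/
theorem exists_young_mul_young : ∃ c : ℂ, c ≠ 0 ∧ young T * young T = c • young T := by
  obtain ⟨c, hc⟩ := exists_colSum_mul_mul_rowSum T (rowSum T * colSum T)
  have h0 : young T * young T = c • young T := by
    rw [young, ← hc]
    simp only [mul_assoc]
  refine ⟨c, ?_, h0⟩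
  rintro rfl
  rw [zero_smul] at h0
  obtain ⟨d, hd, h1⟩ := exists_invol_young_mul_young T
  have h2 : rowSum T * colSum T * rowSum T ≠ 0 := by
    intro h
    rw [h, smul_zero] at h1
    exact invol_mul_self_ne_zero (young_mem_realSubring T) (young_ne_zero T) h1
  have h3 : rowSum T * colSum T * rowSum T ∈ realSubring k :=
    mul_mem (mul_mem (rowSum_mem_realSubring T) (colSum_mem_realSubring T))
      (rowSum_mem_realSubring T)
  apply invol_mul_self_ne_zero h3 h2
  obtain ⟨c', -, h4⟩ := exists_rowSum_mul_self T
  calc invol k (rowSum T * colSum T * rowSum T) * (rowSum T * colSum T * rowSum T)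
      = rowSum T * colSum T * (rowSum T * rowSum T) * colSum T * rowSum T := by
        simp [invol_mul, invol_rowSum, invol_colSum, mul_assoc]
    _ = c' • (rowSum T * (young T * young T)) := by
        rw [h4, young]
        simp [mul_assoc]
    _ = 0 := by rw [h0, mul_zero, smul_zero]

theorem exists_young_mul_mul_young (x : SymAlg k) :
    ∃ c : ℂ, young T * x * young T = c • young T := by
  obtain ⟨c, hc⟩ := exists_colSum_mul_mul_rowSum T (rowSum T * x * colSum T)
  exact ⟨c, by rw [young, ← hc]; simp only [mul_assoc]⟩

/-- The product has the form `a b x b' a'`. For different shapes, transversality can occur in only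
one direction; if it fails in one, the part `a ⋯ b'` vanishes, if in the other, the part `b ⋯ a'`.
-/
theorem young_orthogonal (h : μ ≠ ν) (x : SymAlg k) :
    invol k (young T) * x * young T' = 0 := by
  rw [invol_young, young]
  by_cases h1 : ∀ (S : Tableau μ) (S' : Tableau ν), ¬ Transverse S S'
  · have h2 := rowSum_mul_mul_colSum_eq_zero T T' h1 (colSum T * x)
    rw [← mul_assoc, mul_assoc (rowSum T), mul_assoc (rowSum T), ← mul_assoc] at *
    rw [h2, zero_mul]
  · have h3 : ∀ (S' : Tableau ν) (S : Tableau μ), ¬ Transverse S' S := by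
      push Not at h1
      obtain ⟨S, S', hS⟩ := h1
      intro S₁' S₁ hS'
      exact h (eq_of_transverse hS hS').symm
    have h2 := colSum_mul_mul_rowSum_eq_zero T' T h3 (x * colSum T')
    calc rowSum T * colSum T * x * (colSum T' * rowSum T')
        = rowSum T * (colSum T * (x * colSum T') * rowSum T') := by simp only [mul_assoc]
      _ = 0 := by rw [h2, mul_zero]

theorem mem_specht {x : SymAlg k} : x ∈ specht T ↔ ∃ y, y * young T = x :=
  Submodule.mem_span_singleton

theorem mul_young_mem (x : SymAlg k) : x * young T ∈ specht T := (mem_specht T).2 ⟨x, rfl⟩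

/-- For `x = y e`, regularity gives `t` with `x t x = x`. The sandwich `e (t y) e = c e` yields `c x
= x`, so `c ≠ 0`, and `c⁻¹ e t` sends `x` to `e`. -/
theorem exists_mul_eq_young {x : SymAlg k} (hx : x ∈ specht T) (h : x ≠ 0) :
    ∃ y, y * x = young T := by
  obtain ⟨y, rfl⟩ := (mem_specht T).1 hx
  obtain ⟨t, ht⟩ := exists_mul_mul_eq_self (y * young T)
  obtain ⟨c, hc⟩ := exists_young_mul_mul_young T (t * y)
  have h1 : c • (y * young T) = y * young T := by
    conv_rhs => rw [← ht]
    rw [← mul_smul_comm, ← hc]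
    simp only [mul_assoc]
  have hc0 : c ≠ 0 := by
    rintro rfl
    rw [zero_smul] at h1
    exact h h1.symm
  refine ⟨c⁻¹ • (young T * t), ?_⟩
  rw [smul_mul_assoc, ← mul_assoc, mul_assoc (young T), hc, smul_smul, inv_mul_cancel₀ hc0,
    one_smul]

theorem isSimpleModule_specht : IsSimpleModule (SymAlg k) (specht T) := by
  refine isSimpleModule_iff_toSpanSingleton_surjective.2 ⟨?_, fun x hx y => ?_⟩
  · refine ⟨⟨0, ⟨young T, Submodule.mem_span_singleton_self _⟩, fun h => young_ne_zero T ?_⟩⟩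
    exact (congrArg Subtype.val h).symm
  · obtain ⟨t, ht⟩ := exists_mul_eq_young T x.2 fun h => hx (Subtype.ext h)
    obtain ⟨u, hu⟩ := (mem_specht T).1 y.2
    refine ⟨u * t, Subtype.ext ?_⟩
    rw [← hu, ← ht]
    simp [mul_assoc]

/-- Conjugation by the relabelling `σ`, with `T ∘ σ = T'`, carries the row and column groups of one
tableau to those of the other. -/
theorem young_mul_ofPerm (T T' : Tableau μ) :
    young T * ofPerm (T'.trans T.symm)⁻¹ = ofPerm (T'.trans T.symm)⁻¹ * young T' := by
  set σ : Equiv.Perm (Fin k) := T'.trans T.symm with hσ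
  have hT : ∀ x, T (σ x) = T' x := fun x => by simp [hσ]
  have hT' : ∀ x, T' (σ⁻¹ x) = T x := fun x => by rw [← hT]; simp
  have h1 : rowSum T * ofPerm σ⁻¹ = ofPerm σ⁻¹ * rowSum T' := by
    rw [rowSum, rowSum, Finset.sum_mul, Finset.mul_sum]
    refine Finset.sum_nbij' (fun w => σ⁻¹ * w * σ) (fun w => σ * w * σ⁻¹) ?_ ?_ ?_ ?_ ?_
    · intro w hw
      simp only [Finset.mem_filter, Finset.mem_univ, true_and] at hw ⊢
      intro i
      rw [Equiv.Perm.mul_apply, Equiv.Perm.mul_apply, hT', hw, hT]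
    · intro w hw
      simp only [Finset.mem_filter, Finset.mem_univ, true_and] at hw ⊢
      intro i
      rw [Equiv.Perm.mul_apply, Equiv.Perm.mul_apply, hT, hw, hT']
    · simp [mul_assoc]
    · simp [mul_assoc]
    · simp [ofPerm_mul, mul_assoc]
  have h2 : colSum T * ofPerm σ⁻¹ = ofPerm σ⁻¹ * colSum T' := by
    rw [colSum, colSum, Finset.sum_mul, Finset.mul_sum]
    refine Finset.sum_nbij' (fun w => σ⁻¹ * w * σ) (fun w => σ * w * σ⁻¹) ?_ ?_ ?_ ?_ ?_
    · intro w hw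
      simp only [Finset.mem_filter, Finset.mem_univ, true_and] at hw ⊢
      intro i
      rw [Equiv.Perm.mul_apply, Equiv.Perm.mul_apply, hT', hw, hT]
    · intro w hw
      simp only [Finset.mem_filter, Finset.mem_univ, true_and] at hw ⊢
      intro i
      rw [Equiv.Perm.mul_apply, Equiv.Perm.mul_apply, hT, hw, hT']
    · simp [mul_assoc]
    · simp [mul_assoc]
    · intro w _
      have h : Equiv.Perm.sign (σ⁻¹ * w * σ) = Equiv.Perm.sign w := by
        rw [Equiv.Perm.sign_mul, Equiv.Perm.sign_mul, Equiv.Perm.sign_inv, mul_comm, ← mul_assoc,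
          Int.units_mul_self, one_mul]
      simp only [h]
      simp only [smul_mul_assoc, mul_smul_comm, ofPerm_mul, mul_assoc, mul_inv_cancel, mul_one]
  rw [young, young, mul_assoc, h1, ← mul_assoc, h2, mul_assoc]

theorem nonempty_specht_linearEquiv (T T' : Tableau μ) :
    Nonempty (specht T ≃ₗ[SymAlg k] specht T') := by
  have := isSimpleModule_specht T
  have := isSimpleModule_specht T'
  have h : ∀ x ∈ specht T,
      LinearMap.toSpanSingleton (SymAlg k) (SymAlg k) (ofPerm (T'.trans T.symm)⁻¹) x ∈
        specht T' := by
    intro x hx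
    obtain ⟨y, rfl⟩ := (mem_specht T).1 hx
    rw [LinearMap.toSpanSingleton_apply, smul_eq_mul, mul_assoc, young_mul_ofPerm, ← mul_assoc]
    exact mul_young_mem T' _
  refine ⟨LinearEquiv.ofBijective (LinearMap.restrict _ h) (LinearMap.bijective_of_ne_zero ?_)⟩
  intro h0
  have h1 := congrArg Subtype.val
    (LinearMap.congr_fun h0 ⟨young T, Submodule.mem_span_singleton_self _⟩)
  have h2 : young T * ofPerm (T'.trans T.symm)⁻¹ = 0 := h1
  apply young_ne_zero T
  rw [← mul_one (young T), ← ofPerm_inv_mul (T'.trans T.symm), ← mul_assoc, h2, zero_mul]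

end Young

/-! ### The Specht cell datum of the group algebra of the symmetric group -/

section Pairing

variable {k : ℕ} {μ ν : Nat.Partition k} (T : Tableau μ) (T' : Tableau ν)

/-- The pairing `v^* u` takes values in a single line, by the sandwich lemma; it is a scalar form in
disguise. -/
theorem exists_invol_mul_eq {u v : SymAlg k} (hu : u ∈ specht T) (hv : v ∈ specht T) :
    ∃ c : ℂ, invol k v * u = c • (rowSum T * colSum T * rowSum T) := by
  obtain ⟨x, rfl⟩ := (mem_specht T).1 hu
  obtain ⟨y, rfl⟩ := (mem_specht T).1 hv
  obtain ⟨c, hc⟩ := exists_colSum_mul_mul_rowSum T (invol k y * x * colSum T)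
  refine ⟨c, ?_⟩
  calc invol k (y * young T) * (x * young T)
      = rowSum T * (colSum T * (invol k y * x * colSum T) * rowSum T) := by
        rw [invol_mul, invol_young, young]
        simp only [mul_assoc]
    _ = _ := by rw [hc, mul_smul_comm, mul_assoc]

/-- The generator of that line acts on the Specht module from the right as a nonzero scalar, since
`e a b a` is a nonzero multiple of `e²`. -/
theorem exists_mul_eq_smul : ∃ c : ℂ, c ≠ 0 ∧
    ∀ v ∈ specht T, v * (rowSum T * colSum T * rowSum T) = c • v := by
  obtain ⟨c, hc, h⟩ := exists_rowSum_mul_self T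
  obtain ⟨d, hd, h'⟩ := exists_young_mul_young T
  refine ⟨c * d, mul_ne_zero hc hd, fun v hv => ?_⟩
  obtain ⟨x, rfl⟩ := (mem_specht T).1 hv
  calc x * young T * (rowSum T * colSum T * rowSum T)
      = x * (colSum T * (rowSum T * rowSum T) * young T) := by
        rw [young]
        simp only [mul_assoc]
    _ = c • (x * (young T * young T)) := by
        rw [h, mul_smul_comm, smul_mul_assoc, mul_smul_comm, ← young]
    _ = _ := by rw [h', mul_smul_comm, smul_smul]

theorem invol_mul_eq_zero (h : μ ≠ ν) {u v : SymAlg k} (hv : v ∈ specht T) (hu : u ∈ specht T') :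
    invol k v * u = 0 := by
  obtain ⟨x, rfl⟩ := (mem_specht T').1 hu
  obtain ⟨y, rfl⟩ := (mem_specht T).1 hv
  rw [invol_mul, ← mul_assoc, mul_assoc (invol k (young T)), young_orthogonal T T' h]

/-- A nonzero `y` can be carried to `e` by left multiplication, so `e^* e ≠ 0` prevents degeneracy.
-/
theorem eq_zero_of_invol_mul_eq_zero {y : SymAlg k} (hy : y ∈ specht T)
    (h : ∀ u ∈ specht T, invol k y * u = 0) : y = 0 := by
  by_contra hne
  obtain ⟨t, ht⟩ := exists_mul_eq_young T hy hne
  apply invol_mul_self_ne_zero (young_mem_realSubring T) (young_ne_zero T)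
  conv_lhs => rw [← ht, invol_mul, ht, mul_assoc]
  exact h _ (mul_young_mem T _)

/-- The sum of the conjugates of the product of the Young symmetrizer with its image under the
anti-involution. -/
def youngCentral : SymAlg k :=
  ∑ w, (ofPerm w * young T) * invol k (ofPerm w * young T)

theorem youngCentral_comm (w : Equiv.Perm (Fin k)) :
    ofPerm w * youngCentral T = youngCentral T * ofPerm w := by
  have h : ofPerm w * youngCentral T * ofPerm w⁻¹ = youngCentral T := by
    rw [youngCentral, Finset.mul_sum, Finset.sum_mul]
    refine Finset.sum_nbij' (· * w) (· * w⁻¹) ?_ ?_ ?_ ?_ ?_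
    · simp
    · simp
    · simp
    · simp
    · intro v _
      rw [← ofPerm_mul, mul_assoc (ofPerm w) (ofPerm v), invol_mul (ofPerm w), invol_ofPerm]
      simp only [mul_assoc]
  have h1 := congrArg (· * ofPerm w) h
  simpa only [mul_assoc, ofPerm_inv_mul, mul_one] using h1

theorem invol_youngCentral : invol k (youngCentral T) = youngCentral T := by
  rw [youngCentral, map_sum]
  exact Finset.sum_congr rfl fun w _ => by rw [invol_mul (_ * _), invol_invol]

theorem youngCentral_mem_realSubring : youngCentral T ∈ realSubring k := by
  refine sum_mem fun w _ => mul_mem (mul_mem (ofPerm_mem_realSubring w)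
    (young_mem_realSubring T)) ?_
  rw [invol_mul, invol_ofPerm, invol_young]
  exact mul_mem (mul_mem (rowSum_mem_realSubring T) (colSum_mem_realSubring T))
    (ofPerm_mem_realSubring _)

/-- All summands have the same trace as `e^* e`, which is nonzero. -/
theorem youngCentral_ne_zero : youngCentral T ≠ 0 := by
  intro h
  have h1 := congrArg (tr k) h
  have h2 : ∀ w : Equiv.Perm (Fin k), tr k ((ofPerm w * young T) * invol k (ofPerm w * young T)) =
      tr k (invol k (young T) * young T) := by
    intro w
    rw [tr_mul_comm, invol_mul, invol_ofPerm, mul_assoc, ← mul_assoc (ofPerm w⁻¹),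
      ofPerm_inv_mul, one_mul]
  rw [youngCentral, map_sum, map_zero, Finset.sum_congr rfl fun w _ => h2 w, Finset.sum_const,
    nsmul_eq_mul] at h1
  rcases mul_eq_zero.1 h1 with h3 | h3
  · rw [Nat.cast_eq_zero, Finset.card_univ] at h3
    exact Fintype.card_ne_zero h3
  · exact tr_invol_mul_self_ne_zero (young_mem_realSubring T) (young_ne_zero T) h3

theorem youngCentral_mul_self_ne_zero : youngCentral T * youngCentral T ≠ 0 := by
  have h := invol_mul_self_ne_zero (youngCentral_mem_realSubring T) (youngCentral_ne_zero T)
  rwa [invol_youngCentral] at h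

theorem youngCentral_mul_eq_zero (h : μ ≠ ν) : youngCentral T * youngCentral T' = 0 := by
  rw [youngCentral, youngCentral, Finset.sum_mul_sum]
  refine Finset.sum_eq_zero fun v _ => Finset.sum_eq_zero fun w _ => ?_
  rw [mul_assoc, ← mul_assoc (invol k _),
    invol_mul_eq_zero T T' h (mul_young_mem T _) (mul_young_mem T' _), zero_mul, mul_zero]

end Pairing

/-! ### Central elements as class functions -/

section ClassFunctions

variable {k : ℕ}

/-- The class function with prescribed values on the cycle types. -/
def classFunction (k : ℕ) : (Nat.Partition (Fintype.card (Fin k)) → ℂ) →ₗ[ℂ] SymAlg k :=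
  ∑ w : Equiv.Perm (Fin k), (LinearMap.proj w.partition).smulRight (ofPerm w)

theorem classFunction_apply (f : Nat.Partition (Fintype.card (Fin k)) → ℂ) :
    classFunction k f = ∑ w : Equiv.Perm (Fin k), f w.partition • ofPerm w := by
  simp [classFunction]

theorem mem_range_classFunction {x : SymAlg k} (h : ∀ w, ofPerm w * x = x * ofPerm w) :
    x ∈ LinearMap.range (classFunction k) := by
  classical
  have h1 : ∀ v w, (permBasis k).repr x (v * w * v⁻¹) = (permBasis k).repr x w := by
    intro v w
    have h2 : ofPerm v * x * ofPerm v⁻¹ = x := by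
      rw [h, mul_assoc, ofPerm_mul_inv, mul_one]
    have h3 : (permBasis k).coord w ∘ₗ LinearMap.mulRight ℂ (ofPerm v⁻¹) ∘ₗ
        LinearMap.mulLeft ℂ (ofPerm v) = (permBasis k).coord (v * w * v⁻¹) := by
      refine linearMap_ext_ofPerm fun u => ?_
      simp [ofPerm_mul, Finsupp.single_apply, eq_mul_inv_iff_mul_eq, inv_mul_eq_iff_eq_mul]
    have h4 := LinearMap.congr_fun h3 x
    simp only [LinearMap.comp_apply, LinearMap.mulLeft_apply, LinearMap.mulRight_apply, h2] at h4
    exact h4.symm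
  have h5 : ∀ v w : Equiv.Perm (Fin k), v.partition = w.partition →
      (permBasis k).repr x v = (permBasis k).repr x w := by
    intro v w hvw
    obtain ⟨u, rfl⟩ := isConj_iff.1 (Equiv.Perm.partition_eq_of_isConj.2 hvw)
    exact (h1 u v).symm
  -- The coefficients depend only on the cycle type; the value `0` serves types without a
  -- representative and never enters the sum.
  refine ⟨fun p => if hp : ∃ w : Equiv.Perm (Fin k), w.partition = p then
    (permBasis k).repr x hp.choose else 0, ?_⟩
  rw [classFunction_apply]
  conv_rhs => rw [← sum_repr_smul_ofPerm x]
  refine Finset.sum_congr rfl fun w _ => ?_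
  have hw : ∃ v : Equiv.Perm (Fin k), v.partition = w.partition := ⟨w, rfl⟩
  rw [dif_pos hw, h5 _ _ hw.choose_spec]

end ClassFunctions

/-! ### The cellular basis from bases of the Specht modules -/

section Datum

variable (k : ℕ)

/-- A tableau of each shape. -/
def tab (l : Nat.Partition k) : Tableau l := (nonempty_tableau l).some

/-- The elements `youngCentral` are orthogonal with nonzero squares, hence independent. They lie in
the class functions, whose dimension is at most the number of partitions, so they span them, and `1`
is a class function. -/
theorem one_mem_span_youngCentral :
    (1 : SymAlg k) ∈ Submodule.span ℂ (Set.range fun l => youngCentral (tab k l)) := by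
  have hli : LinearIndependent ℂ fun l => youngCentral (tab k l) := by
    rw [Fintype.linearIndependent_iff]
    intro g hg l
    have h1 := congrArg (· * youngCentral (tab k l)) hg
    simp only [Finset.sum_mul, zero_mul, smul_mul_assoc] at h1
    rw [Finset.sum_eq_single l (fun m _ hm => by
      rw [youngCentral_mul_eq_zero _ _ hm, smul_zero]) (by simp)] at h1
    by_contra hne
    exact youngCentral_mul_self_ne_zero (tab k l) ((IsUnit.mk0 _ hne).smul_eq_zero.1 h1)
  have hle : Submodule.span ℂ (Set.range fun l => youngCentral (tab k l)) ≤
      LinearMap.range (classFunction k) := by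
    rw [Submodule.span_le]
    rintro _ ⟨l, rfl⟩
    exact mem_range_classFunction (youngCentral_comm _)
  have h1 := (LinearMap.finrank_range_le (classFunction k)).trans_eq
    (Module.finrank_fintype_fun_eq_card ℂ)
  have h2 := finrank_span_eq_card hli
  have h3 : Fintype.card (Nat.Partition (Fintype.card (Fin k))) =
      Fintype.card (Nat.Partition k) := by rw [Fintype.card_fin]
  rw [Submodule.eq_of_le_of_finrank_le hle (by omega)]
  exact mem_range_classFunction fun w => by rw [mul_one, one_mul]

variable {k}

instance finite_symAlg : Module.Finite ℂ (SymAlg k) := Module.Finite.of_basis (permBasis k)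

instance finite_specht {μ : Nat.Partition k} (T : Tableau μ) : Module.Finite ℂ (specht T) :=
  Module.Finite.of_injective ((specht T).subtype.restrictScalars ℂ) Subtype.val_injective

/-- A basis of the Specht module. -/
def spechtBasis (l : Nat.Partition k) :
    Module.Basis (Fin (Module.finrank ℂ (specht (tab k l)))) ℂ (specht (tab k l)) :=
  Module.finBasis ℂ _

/-- The elements of the cellular basis. -/
def cellElt (p : Σ l : Nat.Partition k, Fin (Module.finrank ℂ (specht (tab k l))) ×
    Fin (Module.finrank ℂ (specht (tab k l)))) : SymAlg k :=
  (spechtBasis p.1 p.2.1 : SymAlg k) * invol k (spechtBasis p.1 p.2.2 : SymAlg k)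

/-- Group a relation as `∑ s_i * y_i^* = 0` and multiply on the right by `u` in the Specht module of
`l`. Other shapes vanish, and each `y_i^* u` acts as a scalar on the `s_i`, so it is zero by their
independence. Nondegeneracy of the pairing gives `y_i = 0`. -/
theorem linearIndependent_cellElt : LinearIndependent ℂ (cellElt (k := k)) := by
  rw [Fintype.linearIndependent_iff]
  rintro g hg ⟨l, i, j⟩
  let y : ∀ m : Nat.Partition k, Fin (Module.finrank ℂ (specht (tab k m))) → specht (tab k m) :=
    fun m i => ∑ j, g ⟨m, i, j⟩ • spechtBasis m j
  have hsum : ∑ m, ∑ i, (spechtBasis m i : SymAlg k) * invol k (y m i : SymAlg k) = 0 := by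
    rw [← hg, Fintype.sum_sigma]
    refine Finset.sum_congr rfl fun m _ => ?_
    rw [Fintype.sum_prod_type]
    refine Finset.sum_congr rfl fun i _ => ?_
    simp [y, cellElt, Finset.mul_sum]
  obtain ⟨c, hc, hc'⟩ := exists_mul_eq_smul (tab k l)
  have hy : ∀ u ∈ specht (tab k l), invol k (y l i : SymAlg k) * u = 0 := by
    intro u hu
    choose β hβ using fun i => exists_invol_mul_eq (tab k l) hu (y l i).2
    have h1 := congrArg (· * u) hsum
    simp only [Finset.sum_mul, zero_mul, mul_assoc] at h1
    rw [Finset.sum_eq_single l (fun m _ hm => Finset.sum_eq_zero fun i _ => by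
      rw [invol_mul_eq_zero (tab k m) (tab k l) hm (y m i).2 hu, mul_zero]) (by simp)] at h1
    simp only [hβ, mul_smul_comm, hc' _ (Subtype.prop _), smul_smul] at h1
    have h2 : ∑ i, (β i * c) • spechtBasis l i = 0 := by
      apply Subtype.ext
      simpa using h1
    have h3 := Fintype.linearIndependent_iff.1 (spechtBasis l).linearIndependent _ h2 i
    rw [hβ, (mul_eq_zero.1 h3).resolve_right hc, zero_smul]
  have hy0 : y l i = 0 := Subtype.ext (eq_zero_of_invol_mul_eq_zero (tab k l) (y l i).2 hy)
  exact Fintype.linearIndependent_iff.1 (spechtBasis l).linearIndependent _ hy0 j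

theorem mul_invol_mem_span {l : Nat.Partition k} {u v : SymAlg k} (hu : u ∈ specht (tab k l))
    (hv : v ∈ specht (tab k l)) :
    u * invol k v ∈ Submodule.span ℂ (Set.range (cellElt (k := k))) := by
  have h1 := congrArg Subtype.val ((spechtBasis l).sum_repr ⟨u, hu⟩)
  have h2 := congrArg Subtype.val ((spechtBasis l).sum_repr ⟨v, hv⟩)
  simp only [Submodule.coe_sum, Submodule.coe_smul_of_tower] at h1 h2
  rw [← h1, ← h2, map_sum, Finset.sum_mul_sum]
  refine sum_mem fun i _ => sum_mem fun j _ => ?_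
  rw [map_smul, smul_mul_smul_comm]
  exact Submodule.smul_mem _ _ (Submodule.subset_span ⟨⟨l, i, j⟩, rfl⟩)

/-- The span is a left ideal that contains `1`. -/
theorem span_cellElt : ⊤ ≤ Submodule.span ℂ (Set.range (cellElt (k := k))) := by
  have h1 : (1 : SymAlg k) ∈ Submodule.span ℂ (Set.range (cellElt (k := k))) := by
    have hle : Submodule.span ℂ (Set.range fun l => youngCentral (tab k l)) ≤
        Submodule.span ℂ (Set.range (cellElt (k := k))) := by
      rw [Submodule.span_le]
      rintro _ ⟨l, rfl⟩
      exact sum_mem fun w _ => mul_invol_mem_span (mul_young_mem _ _) (mul_young_mem _ _)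
    exact hle (one_mem_span_youngCentral k)
  intro a _
  have h2 : Submodule.span ℂ (Set.range (cellElt (k := k))) ≤
      (Submodule.span ℂ (Set.range (cellElt (k := k)))).comap (LinearMap.mulLeft ℂ a) := by
    rw [Submodule.span_le]
    rintro _ ⟨⟨l, i, j⟩, rfl⟩
    simp only [SetLike.mem_coe, Submodule.mem_comap, LinearMap.mulLeft_apply, cellElt, ← mul_assoc]
    exact mul_invol_mem_span ((specht (tab k l)).smul_mem a (Subtype.prop _)) (Subtype.prop _)
  simpa using h2 h1

/-- Only the left factor moves, so the cell relation holds exactly, without lower terms; this is why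
the discrete order suffices. -/
theorem mul_cellElt (l : Nat.Partition k) (a : SymAlg k)
    (S T : Fin (Module.finrank ℂ (specht (tab k l)))) : a * cellElt ⟨l, S, T⟩ =
      ∑ S', (spechtBasis l).repr (a • spechtBasis l S) S' • cellElt ⟨l, S', T⟩ := by
  have h := congrArg Subtype.val ((spechtBasis l).sum_repr (a • spechtBasis l S))
  simp only [Submodule.coe_sum, Submodule.coe_smul_of_tower] at h
  have h1 := congrArg (· * invol k (spechtBasis l T : SymAlg k)) h
  simp only [Finset.sum_mul, smul_mul_assoc, smul_eq_mul, mul_assoc] at h1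
  exact h1.symm

theorem spechtBasis_equivFun_symm (l : Nat.Partition k) (a : SymAlg k)
    (v : Fin (Module.finrank ℂ (specht (tab k l))) → ℂ) :
    (spechtBasis l).equivFun.symm
      (fun i => ∑ j, (spechtBasis l).repr (a • spechtBasis l j) i * v j) =
      a • (spechtBasis l).equivFun.symm v := by
  rw [Module.Basis.equivFun_symm_apply, Module.Basis.equivFun_symm_apply, Finset.smul_sum]
  simp only [Finset.sum_smul]
  rw [Finset.sum_comm]
  refine Finset.sum_congr rfl fun j _ => ?_
  rw [smul_comm]
  conv_rhs => rw [← (spechtBasis l).sum_repr (a • spechtBasis l j), Finset.smul_sum]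
  refine Finset.sum_congr rfl fun i _ => ?_
  rw [smul_smul, mul_comm]

/-- The discrete order on a type. -/
abbrev discreteOrder (α : Type*) : PartialOrder α where
  le := Eq
  le_refl _ := rfl
  le_trans _ _ _ := Eq.trans
  le_antisymm _ _ h _ := h

variable (k) in
/-- A cell datum of the group algebra of the symmetric group whose cell modules are the Specht
modules. -/
def spechtDatum : letI := discreteOrder (Nat.Partition k)
    CellDatum (invol k) (Nat.Partition k)
      fun l => Fin (Module.finrank ℂ (specht (tab k l))) :=
  letI := discreteOrder (Nat.Partition k)
  { C := Module.Basis.mk linearIndependent_cellElt span_cellElt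
    anti := isAntiInvolution_invol k
    star_C := fun l S T => by
      rw [Module.Basis.mk_apply, Module.Basis.mk_apply, cellElt, cellElt, invol_mul, invol_invol]
    r := fun l a => Matrix.of fun S' S => (spechtBasis l).repr (a • spechtBasis l S) S'
    mul_C := fun l a S T => by
      have h := sub_eq_zero.2 (mul_cellElt l a S T)
      simp only [Module.Basis.mk_apply]
      exact (congrArg (· ∈ Submodule.span ℂ _) h).mpr (zero_mem _) }

theorem nonempty_spechtDatum_linearEquiv {l : Nat.Partition k} (T : Tableau l) :
    letI := discreteOrder (Nat.Partition k)
    Nonempty ((spechtDatum k).CellModule l ≃ₗ[SymAlg k] specht T) := by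
  let := discreteOrder (Nat.Partition k)
  obtain ⟨f⟩ := nonempty_specht_linearEquiv (tab k l) T
  let g : (spechtDatum k).CellModule l ≃ₗ[SymAlg k] specht (tab k l) :=
    { (spechtBasis l).equivFun.symm.toAddEquiv with
      map_smul' := spechtBasis_equivFun_symm l }
  exact ⟨g.trans f⟩

theorem isCellular_invol (k : ℕ) : IsCellular (invol k) :=
  ⟨Nat.Partition k, discreteOrder _, inferInstance, _, _, ⟨spechtDatum k⟩⟩

/-- Every cell datum of the group algebra of the symmetric group that is indexed by the partitions
has nonempty sets `M l`. -/
theorem nonempty_of_cellDatum [PartialOrder (Nat.Partition k)] {M : Nat.Partition k → Type*}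
    [∀ l, Fintype (M l)] (D : CellDatum (invol k) (Nat.Partition k) M) (l : Nat.Partition k) :
    Nonempty (M l) := by
  have hD := D.nondegenerate_of_isSemisimpleRing
  have key : ∀ m : Nat.Partition k, ∃ n, Nonempty (M n) ∧
      Nonempty (specht (tab k m) ≃ₗ[SymAlg k] D.CellModule n) := fun m =>
    have := isSimpleModule_specht (tab k m)
    D.exists_linearEquiv_cellModule hD _
  -- Each partition `m` is sent to the index of the cell module isomorphic to its Specht module.
  -- Specht modules of different shapes are not isomorphic, so `f` is injective, hence onto the
  -- finite set of partitions.
  choose f hf hf' using key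
  have hinj : Function.Injective f := by
    intro m n hmn
    obtain ⟨e₁⟩ := hf' m
    obtain ⟨e₂⟩ := hf' n
    rw [← hmn] at e₂
    let := discreteOrder (Nat.Partition k)
    obtain ⟨e₃⟩ := nonempty_spechtDatum_linearEquiv (tab k m)
    obtain ⟨e₄⟩ := nonempty_spechtDatum_linearEquiv (tab k n)
    have hne : ∀ p : Nat.Partition k,
        Nonempty (Fin (Module.finrank ℂ (specht (tab k p)))) := by
      intro p
      have := isSimpleModule_specht (tab k p)
      have := IsSimpleModule.nontrivial (SymAlg k) (specht (tab k p))
      exact ⟨⟨0, Module.finrank_pos⟩⟩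
    have := hne m
    have := hne n
    exact (spechtDatum k).eq_of_linearEquiv (CellDatum.nondegenerate_of_isSemisimpleRing _ _)
      (CellDatum.nondegenerate_of_isSemisimpleRing _ _)
      ((e₃.trans e₁).trans (e₂.symm.trans e₄.symm))
  obtain ⟨m, rfl⟩ := Finite.surjective_of_injective hinj l
  exact hf m

end Datum

variable {r : ℕ}

/-! ### Partial permutations as triples -/

section Represents

variable {k : ℕ}

/-- The increasing enumeration of a subset. -/
def enum (u : KSubset r k) : Fin k ↪o Fin r := u.1.orderEmbOfFin u.2

theorem exists_enum_eq {u : KSubset r k} {x : Fin r} : (∃ i, enum u i = x) ↔ x ∈ u.1 := by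
  have h := Set.ext_iff.1 (Finset.range_orderEmbOfFin u.1 u.2) x
  exact h.trans Finset.mem_coe

/-- The partial permutation `d` has domain `u`, underlying permutation `w` and image `v`. -/
def Represents (d : Fin r ≃. Fin r) (u : KSubset r k) (w : Equiv.Perm (Fin k))
    (v : KSubset r k) : Prop :=
  ∀ x y, d x = some y ↔ ∃ i, enum u i = x ∧ enum v (w i) = y

variable {d d' : Fin r ≃. Fin r} {u u' v v' : KSubset r k} {w w' : Equiv.Perm (Fin k)}

theorem Represents.apply_enum (h : Represents d u w v) (i : Fin k) :
    d (enum u i) = some (enum v (w i)) := (h _ _).2 ⟨i, rfl, rfl⟩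

theorem Represents.dom_eq (h : Represents d u w v) : dom d = u.1 := by
  ext x
  rw [mem_dom, ← exists_enum_eq]
  constructor
  · rintro ⟨y, hy⟩
    obtain ⟨i, hi, -⟩ := (h x y).1 hy
    exact ⟨i, hi⟩
  · rintro ⟨i, rfl⟩
    exact ⟨_, h.apply_enum i⟩

theorem Represents.symm (h : Represents d u w v) : Represents d.symm v w⁻¹ u := by
  intro x y
  rw [PEquiv.eq_some_iff, h]
  constructor
  · rintro ⟨i, h1, h2⟩
    exact ⟨w i, h2, by simpa using h1⟩
  · rintro ⟨i, h1, h2⟩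
    exact ⟨w⁻¹ i, h2, by simpa using h1⟩

theorem Represents.im_eq (h : Represents d u w v) : im d = v.1 := h.symm.dom_eq

theorem Represents.rank_eq (h : Represents d u w v) : rank d = k := by
  rw [rank, h.dom_eq, u.2]

theorem Represents.trans (h : Represents d u w v) (h' : Represents d' v w' v') :
    Represents (d.trans d') u (w' * w) v' := by
  intro x y
  rw [PEquiv.trans_eq_some]
  constructor
  · rintro ⟨m, h1, h2⟩
    obtain ⟨i, hi, hi'⟩ := (h _ _).1 h1
    obtain ⟨j, hj, hj'⟩ := (h' _ _).1 h2
    obtain rfl := (enum v).injective (hi'.trans hj.symm)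
    exact ⟨i, hi, hj'⟩
  · rintro ⟨i, rfl, rfl⟩
    exact ⟨_, h.apply_enum i, h'.apply_enum _⟩

theorem Represents.unique (h : Represents d u w v) (h' : Represents d u' w' v') :
    u = u' ∧ w = w' ∧ v = v' := by
  obtain rfl : u = u' := Subtype.ext (h.dom_eq.symm.trans h'.dom_eq)
  obtain rfl : v = v' := Subtype.ext (h.im_eq.symm.trans h'.im_eq)
  refine ⟨rfl, ?_, rfl⟩
  ext i : 1
  exact (enum v).injective (Option.some_injective _ ((h.apply_enum i).symm.trans (h'.apply_enum i)))

theorem Represents.eq (h : Represents d u w v) (h' : Represents d' u w v) : d = d' := by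
  ext x y
  rw [h, h']

theorem apply_eq_domEquivIm (d : Fin r ≃. Fin r) (x : dom d) :
    d x = some (domEquivIm d x : Fin r) := by
  simp [domEquivIm]

theorem represents_self (d : Fin r ≃. Fin r) (h : rank d = k) :
    Represents d ⟨dom d, h⟩ (perm d h) ⟨im d, (card_im d).trans h⟩ := by
  have h1 : ∀ i, d (enum (⟨dom d, h⟩ : KSubset r k) i) =
      some (enum (⟨im d, (card_im d).trans h⟩ : KSubset r k) (perm d h i)) := by
    intro i
    have h2 := apply_eq_domEquivIm d ((dom d).orderIsoOfFin h i)
    refine h2.trans (congrArg some ?_)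
    rw [enum, ← Finset.coe_orderIsoOfFin_apply]
    simp [perm]
  intro x y
  constructor
  · intro hxy
    obtain ⟨i, rfl⟩ := (exists_enum_eq (u := (⟨dom d, h⟩ : KSubset r k))).2 (mem_dom.2 ⟨y, hxy⟩)
    exact ⟨i, rfl, Option.some_injective _ ((h1 i).symm.trans hxy)⟩
  · rintro ⟨i, rfl, rfl⟩
    exact h1 i

/-- An embedding as a partial equivalence. -/
def embPEquiv (f : Fin k ↪o Fin r) : Fin k ≃. Fin r where
  toFun i := some (f i)
  invFun := Function.partialInv f
  inv i x := by
    have h := Function.Injective.isPartialInv f.injective i x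
    change _ = some i ↔ some (f i) = some x
    rw [h]
    simp

theorem exists_represents (u : KSubset r k) (w : Equiv.Perm (Fin k)) (v : KSubset r k) :
    ∃ d : Fin r ≃. Fin r, Represents d u w v := by
  refine ⟨(embPEquiv (enum u)).symm.trans (w.toPEquiv.trans (embPEquiv (enum v))), fun x y => ?_⟩
  rw [PEquiv.trans_eq_some]
  refine exists_congr fun i => and_congr ?_ ?_
  · rw [PEquiv.eq_some_iff]
    simp [embPEquiv]
  · rw [PEquiv.trans_eq_some]
    simp [embPEquiv]

/-- The domain, the underlying permutation and the image of a partial permutation. -/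
def triple (d : Fin r ≃. Fin r) :
    Σ k : Fin (r + 1), (KSubset r k × Equiv.Perm (Fin k)) × KSubset r k :=
  ⟨⟨rank d, rank_lt d⟩, (⟨dom d, rfl⟩, perm d rfl), ⟨im d, card_im d⟩⟩

theorem Represents.triple_eq {k : Fin (r + 1)} {u v : KSubset r k} {w : Equiv.Perm (Fin k)}
    (h : Represents d u w v) : triple d = ⟨k, (u, w), v⟩ := by
  obtain ⟨k, hk⟩ := k
  obtain rfl : rank d = k := h.rank_eq
  obtain ⟨rfl, rfl, rfl⟩ := (represents_self d rfl).unique h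
  rfl

theorem triple_bijective : Function.Bijective (triple (r := r)) := by
  constructor
  · intro d d' h
    have h1 : Represents d (k := (triple d).1) (triple d).2.1.1 (triple d).2.1.2 (triple d).2.2 :=
      represents_self d rfl
    have h2 : Represents d' (k := (triple d').1) (triple d').2.1.1 (triple d').2.1.2
      (triple d').2.2 := represents_self d' rfl
    rw [← h] at h2
    exact h1.eq h2
  · rintro ⟨k, ⟨u, w⟩, v⟩
    obtain ⟨d, hd⟩ := exists_represents u w v
    exact ⟨d, hd.triple_eq⟩

end Represents

/-! ### The layers of the algebra of partial permutations -/

section Layers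

variable {k : ℕ}

/-- This lemma and the next one reduce congruences modulo lower layers to basis elements, one linear
argument at a time. -/
theorem mem_of_forall_ofPerm {V : Type*} [AddCommGroup V] [Module ℂ V] (p : Submodule ℂ V)
    (L : SymAlg k →ₗ[ℂ] V) (h : ∀ w, L (ofPerm w) ∈ p) (b : SymAlg k) : L b ∈ p := by
  rw [← sum_repr_smul_ofPerm b, map_sum]
  refine sum_mem fun w _ => ?_
  rw [map_smul]
  exact p.smul_mem _ (h w)

theorem mem_of_forall_single {ι V : Type*} [AddCommGroup V] [Module ℂ V] (p : Submodule ℂ V)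
    (L : (ι →₀ ℂ) →ₗ[ℂ] V) (h : ∀ i, L (Finsupp.single i 1) ∈ p) (x : ι →₀ ℂ) : L x ∈ p := by
  induction x using Finsupp.induction_linear with
  | zero => rw [map_zero]; exact p.zero_mem
  | add f g hf hg => rw [map_add]; exact p.add_mem hf hg
  | single i c =>
    rw [← mul_one c, ← smul_eq_mul, ← Finsupp.smul_single, map_smul]
    exact p.smul_mem _ (h i)

variable (r) in
/-- The basis of the sum of the layers that corresponds to the diagram basis. -/
def layersBasis : Module.Basis (Σ k : Fin (r + 1), (KSubset r k × Equiv.Perm (Fin k)) × KSubset r k)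
    ℂ (Layers ℂ (fun k : Fin (r + 1) => KSubset r k) (fun k => SymAlg k)) :=
  DFinsupp.basis fun k : Fin (r + 1) => ((Finsupp.basisSingleOne.tensorProduct
    (permBasis k)).tensorProduct Finsupp.basisSingleOne)

theorem dfinsuppBasis_apply {ι : Type*} [DecidableEq ι] {η : ι → Type*} {M : ι → Type*}
    [∀ i, AddCommMonoid (M i)] [∀ i, Module ℂ (M i)] (b : ∀ i, Module.Basis (η i) ℂ (M i))
    (p : Σ i, η i) : (DFinsupp.basis b : Module.Basis _ ℂ (⨁ i, M i)) p =
      DirectSum.lof ℂ ι M p.1 (b p.1 p.2) := by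
  obtain ⟨i, j⟩ := p
  apply (DFinsupp.basis b).repr.injective
  rw [Module.Basis.repr_self]
  change _ = (sigmaFinsuppLequivDFinsupp ℂ).symm
    (DFinsupp.mapRange.linearEquiv (fun i => (b i).repr) (DFinsupp.single i (b i j)))
  rw [LinearEquiv.eq_symm_apply]
  simp [DFinsupp.mapRange_single]

theorem layersBasis_apply
    (p : Σ k : Fin (r + 1), (KSubset r k × Equiv.Perm (Fin k)) × KSubset r k) :
    layersBasis r p = DirectSum.lof ℂ (Fin (r + 1))
      (fun k => ((KSubset r k →₀ ℂ) ⊗[ℂ] SymAlg k) ⊗[ℂ] (KSubset r k →₀ ℂ)) p.1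
      (Finsupp.single p.2.1.1 1 ⊗ₜ ofPerm p.2.1.2 ⊗ₜ Finsupp.single p.2.2 1) := by
  refine (dfinsuppBasis_apply _ p).trans (congrArg _ ?_)
  simp [Module.Basis.tensorProduct_apply']

variable (z : ℂ)

variable (r) in
/-- The linear isomorphism of the algebra of partial permutations with the sum of its layers. -/
def layersEquiv : PP r z ≃ₗ[ℂ] Layers ℂ (fun k : Fin (r + 1) => KSubset r k) (fun k => SymAlg k) :=
  (PP.basis r z).equiv (layersBasis r) (Equiv.ofBijective triple triple_bijective)

theorem layersEquiv_basis (d : Fin r ≃. Fin r) :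
    layersEquiv r z (PP.basis r z d) = DirectSum.lof ℂ (Fin (r + 1))
      (fun k => ((KSubset r k →₀ ℂ) ⊗[ℂ] SymAlg k) ⊗[ℂ] (KSubset r k →₀ ℂ)) (triple d).1
      (Finsupp.single (triple d).2.1.1 1 ⊗ₜ ofPerm (triple d).2.1.2 ⊗ₜ
        Finsupp.single (triple d).2.2 1) := by
  rw [layersEquiv, Module.Basis.equiv_apply, layersBasis_apply]
  rfl

variable {k : Fin (r + 1)}

theorem Represents.basis_eq {d : Fin r ≃. Fin r} {u v : KSubset r k} {w : Equiv.Perm (Fin k)}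
    (h : Represents d u w v) : PP.basis r z d = layer (layersEquiv r z) k (Finsupp.single u 1)
      (ofPerm w) (Finsupp.single v 1) := by
  rw [layer, LinearEquiv.eq_symm_apply, layersEquiv_basis, h.triple_eq]

theorem basis_mem_below {d : Fin r ≃. Fin r} (h : rank d < k) :
    PP.basis r z d ∈ below (layersEquiv r z) k := by
  intro j hj
  rw [layersEquiv_basis, DirectSum.lof_eq_of]
  refine DirectSum.of_eq_of_ne _ _ _ ?_
  rintro rfl
  exact hj h

variable (k) in
/-- The elements of a layer, as a trilinear map. -/
def layerLin : (KSubset r k →₀ ℂ) →ₗ[ℂ] SymAlg k →ₗ[ℂ] (KSubset r k →₀ ℂ) →ₗ[ℂ] PP r z :=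
  (TensorProduct.mk ℂ (KSubset r k →₀ ℂ) (SymAlg k)).compr₂
    ((TensorProduct.mk ℂ ((KSubset r k →₀ ℂ) ⊗[ℂ] SymAlg k) (KSubset r k →₀ ℂ)).compr₂
      ((layersEquiv r z).symm.toLinearMap ∘ₗ DirectSum.lof ℂ (Fin (r + 1))
        (fun k => ((KSubset r k →₀ ℂ) ⊗[ℂ] SymAlg k) ⊗[ℂ] (KSubset r k →₀ ℂ)) k))

theorem layerLin_apply (u v : KSubset r k →₀ ℂ) (b : SymAlg k) :
    layerLin z k u b v = layer (layersEquiv r z) k u b v := rfl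

theorem layer_zero (u v : KSubset r k →₀ ℂ) : layer (layersEquiv r z) k u 0 v = 0 := by
  rw [← layerLin_apply, map_zero, LinearMap.zero_apply]

theorem flip_basis (d : Fin r ≃. Fin r) :
    PP.flip r z (PP.basis r z d) = PP.basis r z d.symm := by
  rw [PP.flip, Module.Basis.constr_basis]

theorem basis_mul (d d' : Fin r ≃. Fin r) :
    PP.basis r z d * PP.basis r z d' = z ^ loops d d' • PP.basis r z (d.trans d') :=
  PP.mulLin_basis d d'

theorem isAntiInvolution_flip : IsAntiInvolution (PP.flip r z) := by
  constructor
  · intro a b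
    have h : (LinearMap.mul ℂ (PP r z)).compr₂ (PP.flip r z) =
        ((LinearMap.mul ℂ (PP r z)).compl₁₂ (PP.flip r z) (PP.flip r z)).flip := by
      refine (PP.basis r z).ext fun d => (PP.basis r z).ext fun d' => ?_
      have hl : loops d d' = loops d'.symm d.symm := by
        rw [loops, loops]
        congr 1
        ext m
        rw [Finset.mem_filter, Finset.mem_filter, PEquiv.symm_symm, and_comm (a := d.symm m = none)]
      simp [basis_mul, flip_basis, PEquiv.symm_trans_rev, hl]
    exact LinearMap.congr_fun (LinearMap.congr_fun h a) b
  · intro a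
    have h : PP.flip r z ∘ₗ PP.flip r z = LinearMap.id :=
      (PP.basis r z).ext fun d => by simp [flip_basis]
    exact LinearMap.congr_fun h a

theorem flip_layer (k : Fin (r + 1)) (u v : KSubset r k →₀ ℂ) (b : SymAlg k) :
    PP.flip r z (layer (layersEquiv r z) k u b v) =
      layer (layersEquiv r z) k v (invol k b) u := by
  have h : ∀ w : Equiv.Perm (Fin k), ((layerLin z k).flip (ofPerm w)).compr₂ (PP.flip r z) =
      ((layerLin z k).flip (invol k (ofPerm w))).flip := by
    intro w
    refine Finsupp.basisSingleOne.ext fun u => Finsupp.basisSingleOne.ext fun v => ?_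
    obtain ⟨d, hd⟩ := exists_represents u w v
    simp only [Finsupp.coe_basisSingleOne, LinearMap.compr₂_apply, LinearMap.flip_apply,
      layerLin_apply, invol_ofPerm]
    rw [← hd.basis_eq, flip_basis, hd.symm.basis_eq]
  have h' : PP.flip r z ∘ₗ (layerLin z k u).flip v =
      ((layerLin z k v).flip u) ∘ₗ invol k :=
    linearMap_ext_ofPerm fun w => LinearMap.congr_fun (LinearMap.congr_fun (h w) u) v
  exact LinearMap.congr_fun h' b

theorem restr_apply_eq_some {a : Fin r ≃. Fin r} {u : Finset (Fin r)} {x y : Fin r} :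
    restr a u x = some y ↔ a x = some y ∧ y ∈ u := by
  rw [restr, PEquiv.trans_eq_some]
  constructor
  · rintro ⟨m, h1, h2⟩
    obtain ⟨rfl, h2⟩ := PEquiv.ofSet_eq_some_iff.1 h2
    exact ⟨h1, Finset.mem_coe.1 (PEquiv.ofSet_eq_some_self_iff.1 h2)⟩
  · rintro ⟨h1, h2⟩
    exact ⟨y, h1, PEquiv.ofSet_eq_some_self_iff.2 h2⟩

theorem im_restr {a : Fin r ≃. Fin r} {u : Finset (Fin r)} (h : u ⊆ im a) :
    im (restr a u) = u := by
  ext y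
  rw [mem_im]
  constructor
  · rintro ⟨x, hx⟩
    exact (restr_apply_eq_some.1 hx).2
  · intro hy
    obtain ⟨x, hx⟩ := mem_im.1 (h hy)
    exact ⟨x, restr_apply_eq_some.2 ⟨hx, hy⟩⟩

/-- Points outside `im a` are then automatically outside `dom d`. -/
theorem loops_of_dom_subset {a d : Fin r ≃. Fin r} (h : dom d ⊆ im a) :
    loops a d = r - rank a := by
  rw [loops, ← card_im]
  conv_rhs => enter [1]; rw [← Fintype.card_fin r]
  rw [← Finset.card_compl]
  congr 1
  ext m
  rw [Finset.mem_filter, Finset.mem_compl]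
  constructor
  · rintro ⟨-, h1, -⟩
    simp [im, dom, h1]
  · intro h1
    have h2 : m ∉ dom d := fun h' => h1 (h h')
    simp only [im, dom, Finset.mem_filter, Finset.mem_univ, true_and, Bool.not_eq_true,
      Option.isSome_eq_false_iff, Option.isNone_iff_eq_none] at h1 h2
    exact ⟨Finset.mem_univ _, h1, h2⟩

/-- The image of the composite lies in `im d` and misses `d m` for any `m` in `dom d` outside `im
a`. -/
theorem rank_trans_lt {a d : Fin r ≃. Fin r} (h : ¬ dom d ⊆ im a) : rank (a.trans d) < rank d := by
  rw [← card_im, ← card_im d]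
  obtain ⟨m, hm, hm'⟩ := Finset.not_subset.1 h
  obtain ⟨y, hy⟩ := mem_dom.1 hm
  refine Finset.card_lt_card (Finset.ssubset_iff_of_subset ?_ |>.2 ⟨y, mem_im.2 ⟨m, hy⟩, ?_⟩)
  · intro y hy
    obtain ⟨x, hx⟩ := mem_im.1 hy
    obtain ⟨m, -, h2⟩ := (PEquiv.trans_eq_some _ _ _ _).1 hx
    exact mem_im.2 ⟨m, h2⟩
  · intro hy'
    obtain ⟨x, hx⟩ := mem_im.1 hy'
    obtain ⟨m', h1, h2⟩ := (PEquiv.trans_eq_some _ _ _ _).1 hx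
    obtain rfl := d.inj h2 hy
    exact hm' (mem_im.2 ⟨x, h1⟩)

theorem basis_mul_layer (a : Fin r ≃. Fin r) (u v : KSubset r k) (b : SymAlg k) :
    PP.basis r z a * layer (layersEquiv r z) k (Finsupp.single u 1) b (Finsupp.single v 1) -
      layer (layersEquiv r z) k (phi z k a u) (theta k a u * b) (Finsupp.single v 1) ∈
      below (layersEquiv r z) k := by
  refine mem_of_forall_ofPerm (below (layersEquiv r z) k)
    (LinearMap.mulLeft ℂ (PP.basis r z a) ∘ₗ
      (layerLin z k (Finsupp.single u 1)).flip (Finsupp.single v 1) -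
      (layerLin z k (phi z k a u)).flip (Finsupp.single v 1) ∘ₗ
        LinearMap.mulLeft ℂ (theta k a u)) (fun w => ?_) b
  simp only [LinearMap.sub_apply, LinearMap.comp_apply, LinearMap.mulLeft_apply,
    LinearMap.flip_apply, layerLin_apply]
  obtain ⟨d, hd⟩ := exists_represents u w v
  rw [← hd.basis_eq, basis_mul]
  by_cases h : u.1 ⊆ im a
  · have h1 : Represents (restr a u.1) ⟨dom (restr a u.1), (rank_restr h).trans u.2⟩
        (perm (restr a u.1) ((rank_restr h).trans u.2)) u := by
      have h2 := represents_self (restr a u.1) ((rank_restr h).trans u.2)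
      rwa [show (⟨im (restr a u.1), _⟩ : KSubset r k) = u from Subtype.ext (im_restr h)] at h2
    -- Points that `a` sends outside `u = dom d` go nowhere under `d`, so `a` may be replaced by its
    -- restriction, whose image is exactly `u`.
    have h3 : a.trans d = (restr a u.1).trans d := by
      ext x y
      rw [PEquiv.trans_eq_some, PEquiv.trans_eq_some]
      refine exists_congr fun m => ?_
      rw [restr_apply_eq_some, ← hd.dom_eq, mem_dom]
      constructor
      · rintro ⟨h4, h5⟩
        exact ⟨⟨h4, y, h5⟩, h5⟩
      · rintro ⟨⟨h4, -⟩, h5⟩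
        exact ⟨h4, h5⟩
    rw [h3, (h1.trans hd).basis_eq, loops_of_dom_subset (hd.dom_eq.trans_le h), phi, theta,
      dif_pos h, dif_pos h, ofPerm_mul, ← layerLin_apply, ← layerLin_apply, map_smul]
    simp
  · rw [phi, theta, dif_neg h, dif_neg h, zero_mul, layer_zero, sub_zero]
    refine Submodule.smul_mem _ _ (basis_mem_below z ?_)
    refine (rank_trans_lt ?_).trans_eq hd.rank_eq
    rwa [hd.dom_eq]

theorem isIteratedInflation : IsIteratedInflation (PP.flip r z) (PP.basis r z)
    (fun k : Fin (r + 1) => invol k) (layersEquiv r z) (fun k => phi z k) (fun k => theta k) where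
  anti := isAntiInvolution_flip z
  cellular k := isCellular_invol k
  star_layer k u b v := flip_layer z k u v b
  mul_layer _ a u v b := basis_mul_layer z a u v b

/-! ### The form `ψ` and products within one layer -/

theorem psi_single [DecidableEq (KSubset r k)] (y u : KSubset r k) :
    psi r z k (Finsupp.single y 1) (Finsupp.single u 1) =
      if y = u then z ^ (r - (k : ℕ)) • (1 : SymAlg k) else 0 := by
  simp only [psi, Finsupp.linearCombination_single, one_smul]
  congr

theorem invol_psi (y u : KSubset r k →₀ ℂ) :
    invol k (psi r z k y u) = psi r z k u y := by
  classical
  have h : (psi r z k).compr₂ (invol k) = (psi r z k).flip := by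
    refine Finsupp.basisSingleOne.ext fun y => Finsupp.basisSingleOne.ext fun u => ?_
    simp only [Finsupp.coe_basisSingleOne, LinearMap.compr₂_apply, LinearMap.flip_apply,
      psi_single]
    by_cases hyu : y = u
    · simp [hyu, ← ofPerm_one]
    · simp [hyu, Ne.symm hyu]
  exact LinearMap.congr_fun (LinearMap.congr_fun h y) u

/-- By linearity in `x`, `c`, `y`, `u`, `v`, the left factor is a diagram `d` with image `y`, and
the inflation rule applies. As `u` and `y` both have `k` elements, `u ⊆ im d` forces `u = y`, and
then `r - k` points are omitted. -/
theorem layer_mul_layer (x y u v : KSubset r k →₀ ℂ) (c b : SymAlg k) :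
    layer (layersEquiv r z) k x c y * layer (layersEquiv r z) k u b v -
      layer (layersEquiv r z) k x (c * psi r z k y u * b) v ∈ below (layersEquiv r z) k := by
  classical
  refine mem_of_forall_single (below (layersEquiv r z) k)
    (LinearMap.mulRight ℂ (layerLin z k u b v) ∘ₗ ((layerLin z k).flip c).flip y -
      ((layerLin z k).flip (c * psi r z k y u * b)).flip v) (fun x => ?_) x
  refine mem_of_forall_ofPerm (below (layersEquiv r z) k)
    (LinearMap.mulRight ℂ (layerLin z k u b v) ∘ₗ (layerLin z k (Finsupp.single x 1)).flip y -
      (layerLin z k (Finsupp.single x 1)).flip v ∘ₗ LinearMap.mulRight ℂ b ∘ₗ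
        LinearMap.mulRight ℂ (psi r z k y u)) (fun w => ?_) c
  refine mem_of_forall_single (below (layersEquiv r z) k)
    (LinearMap.mulRight ℂ (layerLin z k u b v) ∘ₗ layerLin z k (Finsupp.single x 1) (ofPerm w) -
      (layerLin z k (Finsupp.single x 1)).flip v ∘ₗ LinearMap.mulRight ℂ b ∘ₗ
        LinearMap.mulLeft ℂ (ofPerm w) ∘ₗ (psi r z k).flip u) (fun y => ?_) y
  obtain ⟨d, hd⟩ := exists_represents x w y
  refine mem_of_forall_single (below (layersEquiv r z) k)
    (LinearMap.mulLeft ℂ (layerLin z k (Finsupp.single x 1) (ofPerm w) (Finsupp.single y 1)) ∘ₗ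
      ((layerLin z k).flip b).flip v - (layerLin z k (Finsupp.single x 1)).flip v ∘ₗ
        LinearMap.mulRight ℂ b ∘ₗ LinearMap.mulLeft ℂ (ofPerm w) ∘ₗ
          psi r z k (Finsupp.single y 1)) (fun u => ?_) u
  refine mem_of_forall_single (below (layersEquiv r z) k)
    (LinearMap.mulLeft ℂ (layerLin z k (Finsupp.single x 1) (ofPerm w) (Finsupp.single y 1)) ∘ₗ
      layerLin z k (Finsupp.single u 1) b - layerLin z k (Finsupp.single x 1)
        (ofPerm w * psi r z k (Finsupp.single y 1) (Finsupp.single u 1) * b)) (fun v => ?_) v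
  have h := basis_mul_layer z d u v b
  simp only [LinearMap.sub_apply, LinearMap.comp_apply, LinearMap.mulLeft_apply, layerLin_apply]
  rw [← hd.basis_eq]
  by_cases hyu : y = u
  · obtain rfl := hyu
    have h1 : y.1 ⊆ im d := hd.im_eq.ge
    have h2 : restr d y.1 = d := by
      ext a b
      rw [restr_apply_eq_some, and_iff_left_iff_imp,
        ← hd.im_eq, mem_im]
      exact fun h => ⟨a, h⟩
    have h3 : Represents (restr d y.1) x w y := by rwa [h2]
    obtain ⟨h4, h5, -⟩ := (represents_self (restr d y.1) ((rank_restr h1).trans y.2)).unique h3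
    rw [phi, theta, dif_pos h1, dif_pos h1, h4, h5, hd.rank_eq] at h
    rw [psi_single, if_pos rfl]
    convert h using 2
    rw [← layerLin_apply, ← layerLin_apply, map_smul, mul_smul_comm, mul_one, smul_mul_assoc,
      map_smul]
    rfl
  · have h1 : ¬ u.1 ⊆ im d := by
      rw [hd.im_eq]
      intro h
      exact hyu (Subtype.ext (Finset.eq_of_subset_of_card_le h (by rw [u.2, y.2]))).symm
    rw [phi, theta, dif_neg h1, dif_neg h1, zero_mul, layer_zero, sub_zero] at h
    rw [psi_single, if_neg hyu, mul_zero, zero_mul, layer_zero, sub_zero]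
    exact h

end Layers

/-! ### Standard bases of cell modules -/

namespace CellDatum

variable {K A : Type*} [CommRing K] [Ring A] [Algebra K A] {s : A →ₗ[K] A} {Λ : Type*}
  [PartialOrder Λ] {M : Λ → Type*} [∀ l, Fintype (M l)] (D : CellDatum s Λ M)

/-- A cell module as a space of functions. -/
def vecEquiv (l : Λ) : D.CellModule l ≃ₗ[K] (M l → K) where
  toFun v := v
  invFun v := v
  map_add' _ _ := rfl
  map_smul' _ _ := rfl
  left_inv _ := rfl
  right_inv _ := rfl

/-- The standard basis of a cell module. -/
def vecBasis (l : Λ) : Module.Basis (M l) K (D.CellModule l) :=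
  Module.Basis.ofEquivFun (D.vecEquiv l)

theorem vecBasis_apply (l : Λ) (S : M l) : D.vecBasis l S = D.vec l S := by
  classical
  refine (congrFun (Module.Basis.coe_ofEquivFun (D.vecEquiv l)) S).trans ?_
  change (Pi.single S 1 : M l → K) = _
  simp only [vec]

theorem smul_vec_eq_sum (l : Λ) (a : A) (S : M l) :
    a • D.vec l S = ∑ S', D.r l a S' S • D.vec l S' := by
  simp_rw [← D.vecBasis_apply]
  rw [← (D.vecBasis l).sum_repr (a • D.vecBasis l S)]
  refine Finset.sum_congr rfl fun S' _ => ?_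
  rw [← D.smul_vec l a S S', vecBasis_apply]
  rfl

end CellDatum

/-! ### The cell datum of the algebra of partial permutations -/

theorem sum_single_smul {ι : Type*} [Fintype ι] (u : ι →₀ ℂ) :
    ∑ x, u x • Finsupp.single x (1 : ℂ) = u := by
  simp

section Inflated

variable (z : ℂ) {M : ∀ k : Fin (r + 1), Nat.Partition k → Type*} [∀ k l, Fintype (M k l)]
  [∀ k : Fin (r + 1), PartialOrder (Nat.Partition k)]
  (D : ∀ k : Fin (r + 1), CellDatum (invol k) (Nat.Partition k) (M k))

/-- The rearrangement of the index set of the cellular basis. -/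
def indexEquiv (M : ∀ k : Fin (r + 1), Nat.Partition k → Type*) :
    (Σ k : Fin (r + 1), (KSubset r k × Σ l, M k l × M k l) × KSubset r k) ≃
      Σ l : Lam r, (KSubset r (ofLex l).1 × M (ofLex l).1 (ofLex l).2) ×
        (KSubset r (ofLex l).1 × M (ofLex l).1 (ofLex l).2) where
  toFun p := ⟨toLex ⟨p.1, p.2.1.2.1⟩, (p.2.1.1, p.2.1.2.2.1), (p.2.2, p.2.1.2.2.2)⟩
  invFun q := ⟨(ofLex q.1).1, (q.2.1.1, ⟨(ofLex q.1).2, q.2.1.2, q.2.2.2⟩), q.2.2.1⟩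
  left_inv _ := rfl
  right_inv _ := rfl

/-- The basis of the algebra of partial permutations by layers. -/
def layerCellBasis : Module.Basis (Σ k : Fin (r + 1),
    (KSubset r k × Σ l, M k l × M k l) × KSubset r k) ℂ (PP r z) :=
  (DFinsupp.basis fun k : Fin (r + 1) => ((Finsupp.basisSingleOne.tensorProduct
    (D k).C).tensorProduct Finsupp.basisSingleOne) :
      Module.Basis _ ℂ (Layers ℂ (fun k : Fin (r + 1) => KSubset r k) (fun k => SymAlg k))).map
    (layersEquiv r z).symm

theorem layerCellBasis_apply
    (p : Σ k : Fin (r + 1), (KSubset r k × Σ l, M k l × M k l) × KSubset r k) :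
    layerCellBasis z D p = layer (layersEquiv r z) p.1 (Finsupp.single p.2.1.1 1)
      ((D p.1).C p.2.1.2) (Finsupp.single p.2.2 1) := by
  rw [layerCellBasis, Module.Basis.map_apply, layer]
  refine congrArg _ ((dfinsuppBasis_apply _ p).trans (congrArg _ ?_))
  simp [Module.Basis.tensorProduct_apply']

/-- The cellular basis of the algebra of partial permutations. -/
def cellBasis : Module.Basis (Σ l : Lam r, (KSubset r (ofLex l).1 × M (ofLex l).1 (ofLex l).2) ×
    (KSubset r (ofLex l).1 × M (ofLex l).1 (ofLex l).2)) ℂ (PP r z) :=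
  (layerCellBasis z D).reindex (indexEquiv M)

/-- The elements of the cellular basis. -/
def cellVec (k : Fin (r + 1)) (l : Nat.Partition k) (S T : KSubset r k × M k l) : PP r z :=
  cellBasis z D ⟨toLex ⟨k, l⟩, S, T⟩

theorem cellVec_eq (k : Fin (r + 1)) (l : Nat.Partition k) (S T : KSubset r k × M k l) :
    cellVec z D k l S T = layer (layersEquiv r z) k (Finsupp.single S.1 1)
      ((D k).C ⟨l, S.2, T.2⟩) (Finsupp.single T.1 1) :=
  ((layerCellBasis z D).reindex_apply (indexEquiv M) _).trans
    (layerCellBasis_apply z D ⟨k, (S.1, ⟨l, S.2, T.2⟩), T.1⟩)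

/-- The span of the lower cells. -/
def cellLower (l : Lam r) : Submodule ℂ (PP r z) :=
  Submodule.span ℂ {x | ∃ m, m < l ∧ ∃ X Y : KSubset r (ofLex m).1 × M (ofLex m).1 (ofLex m).2,
    x = cellBasis z D ⟨m, X, Y⟩}

theorem layer_single_mem {k : Fin (r + 1)} (p : Submodule ℂ (PP r z)) (x y : KSubset r k)
    (h : ∀ l X Y, cellVec z D k l (x, X) (y, Y) ∈ p) (b : SymAlg k) :
    layer (layersEquiv r z) k (Finsupp.single x 1) b (Finsupp.single y 1) ∈ p := by
  have h1 : (⊤ : Submodule ℂ (SymAlg k)) ≤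
      p.comap ((layerLin z k (Finsupp.single x 1)).flip (Finsupp.single y 1)) := by
    rw [← (D k).C.span_eq, Submodule.span_le]
    rintro _ ⟨⟨l, X, Y⟩, rfl⟩
    have h2 := h l X Y
    rwa [cellVec_eq] at h2
  exact h1 (Submodule.mem_top (x := b))

theorem below_le_cellLower (k : Fin (r + 1)) (l : Nat.Partition k) :
    below (layersEquiv r z) k ≤ cellLower z D (toLex ⟨k, l⟩) := by
  intro x hx
  rw [← (layersEquiv r z).symm_apply_apply x, ← DirectSum.sum_univ_of (layersEquiv r z x),
    map_sum]
  refine sum_mem fun j _ => ?_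
  by_cases hj : j < k
  · generalize (layersEquiv r z) x j = t
    induction t using TensorProduct.induction_on with
    | zero => simp
    | add s t hs ht => rw [map_add, map_add]; exact add_mem hs ht
    | tmul s v =>
      induction s using TensorProduct.induction_on with
      | zero => simp
      | add s t hs ht => rw [TensorProduct.add_tmul, map_add, map_add]; exact add_mem hs ht
      | tmul u b =>
        change layer (layersEquiv r z) j u b v ∈ _
        refine mem_of_forall_single _ (((layerLin z j).flip b).flip v) (fun x => ?_) u
        refine mem_of_forall_single _ (layerLin z j (Finsupp.single x 1) b) (fun y => ?_) v
        refine layer_single_mem z D _ x y (fun m X Y => Submodule.subset_span ?_) b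
        exact ⟨toLex ⟨j, m⟩, Sigma.Lex.lt_def.2 (Or.inl hj), _, _, rfl⟩
  · rw [hx j hj, map_zero, map_zero]
    exact zero_mem _

theorem layer_lower_mem_cellLower (k : Fin (r + 1)) (l : Nat.Partition k) {b : SymAlg k}
    (hb : b ∈ Submodule.span ℂ {x | ∃ m, m < l ∧ ∃ X Y : M k m, x = (D k).C ⟨m, X, Y⟩})
    (u : KSubset r k →₀ ℂ) (y : KSubset r k) :
    layer (layersEquiv r z) k u b (Finsupp.single y 1) ∈ cellLower z D (toLex ⟨k, l⟩) := by
  have h1 : Submodule.span ℂ {x | ∃ m, m < l ∧ ∃ X Y : M k m, x = (D k).C ⟨m, X, Y⟩} ≤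
      (cellLower z D (toLex ⟨k, l⟩)).comap ((layerLin z k u).flip (Finsupp.single y 1)) := by
    rw [Submodule.span_le]
    rintro _ ⟨m, hm, X, Y, rfl⟩
    change layerLin z k u ((D k).C ⟨m, X, Y⟩) (Finsupp.single y 1) ∈
      cellLower z D (toLex ⟨k, l⟩)
    refine mem_of_forall_single _ (((layerLin z k).flip ((D k).C ⟨m, X, Y⟩)).flip
      (Finsupp.single y 1)) (fun x => ?_) u
    refine Submodule.subset_span ⟨toLex ⟨k, m⟩, Sigma.Lex.lt_def.2 (Or.inr ⟨rfl, hm⟩), (x, X),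
      (y, Y), ?_⟩
    exact (cellVec_eq z D k m (x, X) (y, Y)).symm
  exact h1 hb

/-- The matrix of a diagram on a cell module. -/
def cellMatrix (k : Fin (r + 1)) (l : Nat.Partition k) (a : Fin r ≃. Fin r) :
    Matrix (KSubset r k × M k l) (KSubset r k × M k l) ℂ :=
  Matrix.of fun S' S => phi z k a S.1 S'.1 * (D k).r l (theta k a S.1) S'.2 S.2

/-- The error has two sources: lower layers from the inflation rule, and lower cells of `B(k)` from
multiplying its cellular basis by `theta k a x`. Both are lower in the lexicographic order. -/
theorem basis_mul_cellVec (k : Fin (r + 1)) (l : Nat.Partition k) (a : Fin r ≃. Fin r)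
    (S T : KSubset r k × M k l) : PP.basis r z a * cellVec z D k l S T -
      ∑ S', cellMatrix z D k l a S' S • cellVec z D k l S' T ∈
      cellLower z D (toLex ⟨k, l⟩) := by
  obtain ⟨x, X⟩ := S
  obtain ⟨y, Y⟩ := T
  have h1 := below_le_cellLower z D k l (basis_mul_layer z a x y ((D k).C ⟨l, X, Y⟩))
  have h2 := layer_lower_mem_cellLower z D k l ((D k).mul_C l (theta k a x) X Y) (phi z k a x) y
  have h3 : ∑ S', cellMatrix z D k l a S' (x, X) • cellVec z D k l S' (y, Y) =
      layer (layersEquiv r z) k (phi z k a x)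
        (∑ X', (D k).r l (theta k a x) X' X • (D k).C ⟨l, X', Y⟩) (Finsupp.single y 1) := by
    rw [Fintype.sum_prod_type]
    conv_rhs => rw [← sum_single_smul (phi z k a x)]
    simp only [← layerLin_apply, map_sum, map_smul, LinearMap.sum_apply, LinearMap.smul_apply,
      cellVec_eq, cellMatrix, Matrix.of_apply, Finset.smul_sum, smul_smul]
    rw [Finset.sum_comm]
    simp only [mul_comm]
  rw [h3, cellVec_eq]
  rw [← layerLin_apply, map_sub, LinearMap.sub_apply, layerLin_apply, layerLin_apply] at h2
  simpa using add_mem h1 h2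

/-- The matrices of the elements of the algebra on a cell module. -/
def cellRep (k : Fin (r + 1)) (l : Nat.Partition k) :
    PP r z →ₗ[ℂ] Matrix (KSubset r k × M k l) (KSubset r k × M k l) ℂ :=
  (PP.basis r z).constr ℂ (cellMatrix z D k l)

theorem cellRep_basis (k : Fin (r + 1)) (l : Nat.Partition k) (a : Fin r ≃. Fin r) :
    cellRep z D k l (PP.basis r z a) = cellMatrix z D k l a :=
  (PP.basis r z).constr_basis ℂ _ a

theorem mul_cellVec (k : Fin (r + 1)) (l : Nat.Partition k) (a : PP r z)
    (S T : KSubset r k × M k l) : a * cellVec z D k l S T -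
      ∑ S', cellRep z D k l a S' S • cellVec z D k l S' T ∈ cellLower z D (toLex ⟨k, l⟩) := by
  induction (PP.basis r z).mem_span a using Submodule.span_induction with
  | zero => simp
  | mem x hx =>
    obtain ⟨d, rfl⟩ := hx
    rw [cellRep_basis]
    exact basis_mul_cellVec z D k l d S T
  | add a b _ _ ha hb =>
    convert add_mem ha hb using 1
    simp only [map_add, add_mul, Matrix.add_apply, add_smul, Finset.sum_add_distrib]
    abel
  | smul c a _ ha =>
    convert Submodule.smul_mem _ c ha using 1
    simp only [map_smul, smul_mul_assoc, Matrix.smul_apply, smul_assoc, smul_sub, Finset.smul_sum]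

theorem flip_cellVec (k : Fin (r + 1)) (l : Nat.Partition k) (S T : KSubset r k × M k l) :
    PP.flip r z (cellVec z D k l S T) = cellVec z D k l T S := by
  rw [cellVec_eq, cellVec_eq, flip_layer, (D k).star_C]

/-- The cell datum of the algebra of partial permutations that belongs to cell data of the group
algebras of the symmetric groups. -/
def inflate : CellDatum (PP.flip r z) (Lam r)
    (fun l => KSubset r (ofLex l).1 × M (ofLex l).1 (ofLex l).2) where
  C := cellBasis z D
  anti := isAntiInvolution_flip z
  star_C l S T := flip_cellVec z D (ofLex l).1 (ofLex l).2 S T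
  r l a := cellRep z D (ofLex l).1 (ofLex l).2 a
  mul_C l a S T := mul_cellVec z D (ofLex l).1 (ofLex l).2 a S T

theorem inflate_C (k : Fin (r + 1)) (l : Nat.Partition k) (x y : KSubset r k) (X Y : M k l) :
    (inflate z D).C ⟨toLex ⟨k, l⟩, (x, X), (y, Y)⟩ =
      layer (layersEquiv r z) k (Finsupp.single x 1) ((D k).C ⟨l, X, Y⟩) (Finsupp.single y 1) :=
  cellVec_eq z D k l (x, X) (y, Y)

/-- The basis vectors of a cell module of the algebra of partial permutations. -/
def inflateVec (k : Fin (r + 1)) (l : Nat.Partition k) (S : KSubset r k × M k l) :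
    (inflate z D).CellModule (toLex ⟨k, l⟩) :=
  (inflate z D).vec (toLex ⟨k, l⟩) S

theorem smul_inflateVec (k : Fin (r + 1)) (l : Nat.Partition k) (a : Fin r ≃. Fin r)
    (S : KSubset r k × M k l) : PP.basis r z a • inflateVec z D k l S =
      ∑ S', cellMatrix z D k l a S' S • inflateVec z D k l S' := by
  rw [← cellRep_basis]
  exact (inflate z D).smul_vec_eq_sum (toLex ⟨k, l⟩) (PP.basis r z a) S

/-- The basis of a cell module of the algebra of partial permutations. -/
def inflateVecBasis (k : Fin (r + 1)) (l : Nat.Partition k) :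
    Module.Basis (KSubset r k × M k l) ℂ ((inflate z D).CellModule (toLex ⟨k, l⟩)) :=
  (inflate z D).vecBasis (toLex ⟨k, l⟩)

theorem inflateVecBasis_apply (k : Fin (r + 1)) (l : Nat.Partition k) (S : KSubset r k × M k l) :
    inflateVecBasis z D k l S = inflateVec z D k l S :=
  (inflate z D).vecBasis_apply (toLex ⟨k, l⟩) S

/-- The cell modules of the algebra of partial permutations as tensor products. -/
def inflateCellModule (k : Fin (r + 1)) (l : Nat.Partition k) :
    (inflate z D).CellModule (toLex ⟨k, l⟩) ≃ₗ[ℂ] (KSubset r k →₀ ℂ) ⊗[ℂ] (D k).CellModule l :=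
  (inflateVecBasis z D k l).equiv
    (Finsupp.basisSingleOne.tensorProduct ((D k).vecBasis l)) (Equiv.refl _)

theorem inflateCellModule_vec (k : Fin (r + 1)) (l : Nat.Partition k) (x : KSubset r k)
    (X : M k l) : inflateCellModule z D k l (inflateVec z D k l (x, X)) =
      Finsupp.single x 1 ⊗ₜ (D k).vec l X := by
  rw [← inflateVecBasis_apply, inflateCellModule, Module.Basis.equiv_apply, Equiv.refl_apply,
    Module.Basis.tensorProduct_apply, CellDatum.vecBasis_apply, Finsupp.coe_basisSingleOne]

theorem inflateCellModule_smul (k : Fin (r + 1)) (l : Nat.Partition k) (a : Fin r ≃. Fin r)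
    (x : KSubset r k) (s : (D k).CellModule l) :
    inflateCellModule z D k l (PP.basis r z a •
      (inflateCellModule z D k l).symm (Finsupp.single x 1 ⊗ₜ s)) =
      phi z k a x ⊗ₜ (theta k a x • s) := by
  have h : (inflateCellModule z D k l).toLinearMap ∘ₗ
      Algebra.lsmul ℂ ℂ ((inflate z D).CellModule (toLex ⟨k, l⟩)) (PP.basis r z a) ∘ₗ
      (inflateCellModule z D k l).symm.toLinearMap ∘ₗ
      TensorProduct.mk ℂ (KSubset r k →₀ ℂ) ((D k).CellModule l) (Finsupp.single x 1) =
      TensorProduct.mk ℂ (KSubset r k →₀ ℂ) ((D k).CellModule l) (phi z k a x) ∘ₗ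
        Algebra.lsmul ℂ ℂ ((D k).CellModule l) (theta k a x) := by
    refine ((D k).vecBasis l).ext fun X => ?_
    simp only [LinearMap.comp_apply, TensorProduct.mk_apply, LinearEquiv.coe_coe,
      Algebra.lsmul_coe, CellDatum.vecBasis_apply]
    rw [← inflateCellModule_vec, LinearEquiv.symm_apply_apply, smul_inflateVec, map_sum,
      CellDatum.smul_vec_eq_sum, Fintype.sum_prod_type]
    conv_rhs => rw [← sum_single_smul (phi z k a x), TensorProduct.sum_tmul]
    refine Finset.sum_congr rfl fun x' _ => ?_
    rw [TensorProduct.tmul_sum]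
    refine Finset.sum_congr rfl fun X' _ => ?_
    rw [map_smul, inflateCellModule_vec, TensorProduct.smul_tmul_smul]
    rfl
  exact LinearMap.congr_fun h s

/-! ### The Graham-Lehrer form on the inflated cell modules -/

theorem repr_layer (k : Fin (r + 1)) (l : Nat.Partition k) (x y : KSubset r k) (X Y : M k l)
    (b : SymAlg k) : (inflate z D).C.repr
      (layer (layersEquiv r z) k (Finsupp.single x 1) b (Finsupp.single y 1))
        ⟨toLex ⟨k, l⟩, (x, X), (y, Y)⟩ = (D k).C.repr b ⟨l, X, Y⟩ := by
  classical
  have h : (inflate z D).C.coord ⟨toLex ⟨k, l⟩, (x, X), (y, Y)⟩ ∘ₗ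
      (layerLin z k (Finsupp.single x 1)).flip (Finsupp.single y 1) =
      (D k).C.coord ⟨l, X, Y⟩ := by
    refine (D k).C.ext ?_
    rintro ⟨m, X', Y'⟩
    simp only [LinearMap.comp_apply, LinearMap.flip_apply, layerLin_apply,
      Module.Basis.coord_apply]
    rw [← inflate_C, Module.Basis.repr_self, Module.Basis.repr_self, Finsupp.single_apply,
      Finsupp.single_apply]
    congr 1
    apply propext
    constructor
    · intro h
      cases h
      rfl
    · intro h
      cases h
      rfl
  exact LinearMap.congr_fun h b

/-- The form is a coefficient of the product of two diagonal cell elements, which modulo lower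
layers is governed by `ψ`. -/
theorem inflate_form (k : Fin (r + 1)) (l : Nat.Partition k) (y u : KSubset r k) (Y U : M k l)
    [Decidable (y = u)] :
    (inflate z D).form (toLex ⟨k, l⟩) (y, Y) (u, U) =
      if y = u then z ^ (r - (k : ℕ)) * (D k).form l Y U else 0 := by
  classical
  rw [CellDatum.form, (inflate z D).r_eq (toLex ⟨k, l⟩) _ _ _ (u, U), inflate_C, inflate_C]
  have h1 := (inflate z D).repr_lower (below_le_cellLower z D k l (layer_mul_layer z
    (Finsupp.single y 1) (Finsupp.single y 1) (Finsupp.single u 1) (Finsupp.single u 1)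
      ((D k).C ⟨l, Y, Y⟩) ((D k).C ⟨l, U, U⟩))) (y, Y) (u, U)
  rw [map_sub, Finsupp.sub_apply, sub_eq_zero] at h1
  rw [h1, psi_single]
  split_ifs with h
  · rw [mul_smul_comm, mul_one, smul_mul_assoc, ← layerLin_apply, map_smul, LinearMap.smul_apply,
      layerLin_apply, map_smul, Finsupp.smul_apply, repr_layer, CellDatum.form,
      (D k).r_eq l _ _ _ U, smul_eq_mul]
  · rw [mul_zero, zero_mul, layer_zero, map_zero, Finsupp.zero_apply]

/-- The Gram matrix is block diagonal over the `k`-subsets. In each block the nonzero factor `z ^ (r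
- k)` cancels, leaving the form of `B(k)`, which is nondegenerate for any cell datum because `ℂS_k`
is semisimple. -/
theorem inflate_nondegenerate (hz : z ≠ 0) (l : Lam r) : (inflate z D).Nondegenerate l := by
  classical
  suffices h : ∀ (k : Fin (r + 1)) (l : Nat.Partition k) (v : KSubset r k × M k l → ℂ),
      (∀ T : KSubset r k × M k l, ∑ U : KSubset r k × M k l,
        (inflate z D).form (toLex ⟨k, l⟩) T U * v U = 0) → v = 0 from
    fun v hv => h (ofLex l).1 (ofLex l).2 v hv
  intro k l v hv
  funext ⟨y, Y⟩
  refine congrFun ((D k).nondegenerate_of_isSemisimpleRing l (fun U => v (y, U)) fun Y' => ?_) Y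
  have h1 : ∑ p : KSubset r k × M k l,
      (if y = p.1 then z ^ (r - (k : ℕ)) * (D k).form l Y' p.2 else 0) * v p = (0 : ℂ) :=
    (Finset.sum_congr rfl fun p _ =>
      congrArg (· * v p) (inflate_form z D k l y p.1 Y' p.2).symm).trans (hv (y, Y'))
  rw [Fintype.sum_prod_type, Finset.sum_eq_single y
    (fun x _ hx => Finset.sum_eq_zero fun X _ => by rw [if_neg hx.symm, zero_mul])
    (fun h => absurd (Finset.mem_univ y) h)] at h1
  simp only [if_true, mul_assoc] at h1
  rw [← Finset.mul_sum] at h1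
  exact (mul_eq_zero.1 h1).resolve_left (pow_ne_zero _ hz)

theorem nonempty_inflate (D : ∀ k : Fin (r + 1), CellDatum (invol k) (Nat.Partition k) (M k))
    (l : Lam r) : Nonempty (KSubset r (ofLex l).1 × M (ofLex l).1 (ofLex l).2) := by
  obtain ⟨k, l⟩ := l
  obtain ⟨X⟩ := nonempty_of_cellDatum (D k) l
  obtain ⟨u, -, hu⟩ := Finset.exists_subset_card_eq
    (s := (Finset.univ : Finset (Fin r))) (n := k) (by simpa using Nat.le_of_lt_succ k.2)
  exact ⟨(⟨u, hu⟩, X)⟩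

instance finite_lam : Finite (Lam r) :=
  inferInstanceAs (Finite (Σ k : Fin (r + 1), Nat.Partition k))

end Inflated

end PartialPerm

end

/-! ### The structure theorem for the algebra of partial permutations -/

theorem theorem7p12 (r : ℕ) (z : ℂ) :
    -- `A` is the sum of the `U(k) ⊗ B(k) ⊗ U(k)`, where `d` is `dom d ⊗ π(d) ⊗ im d`
    ∃ e : PP r z ≃ₗ[ℂ] Layers ℂ (fun k : Fin (r + 1) => KSubset r k) (fun k => SymAlg k),
      (∀ d : Fin r ≃. Fin r, PP.basis r z d =
        layer e ⟨rank d, rank_lt d⟩ (Finsupp.single ⟨dom d, rfl⟩ 1) (ofPerm (perm d rfl))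
          (Finsupp.single ⟨im d, card_im d⟩ 1)) ∧
      -- `A` is an iterated inflation
      IsIteratedInflation (PP.flip r z) (PP.basis r z) (fun k : Fin (r + 1) => invol k) e
        (fun k => phi z k) (fun k => theta k) ∧
      -- the cell modules, for any choice of cell data of the group algebras `B(k)`
      (∀ (M : ∀ k : Fin (r + 1), Nat.Partition k → Type*) [∀ k l, Fintype (M k l)]
        [∀ k : Fin (r + 1), PartialOrder (Nat.Partition k)]
        (D : ∀ k : Fin (r + 1), CellDatum (invol k) (Nat.Partition k) (M k)),
        ∃ E : CellDatum (PP.flip r z) (Lam r)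
            (fun l => KSubset r (ofLex l).1 × M (ofLex l).1 (ofLex l).2),
          (∀ (k : Fin (r + 1)) (l : Nat.Partition k) (x y : KSubset r k) (X Y : M k l),
            E.C ⟨toLex ⟨k, l⟩, (x, X), (y, Y)⟩ =
              layer e k (Finsupp.single x 1) ((D k).C ⟨l, X, Y⟩) (Finsupp.single y 1)) ∧
          (∀ (k : Fin (r + 1)) (l : Nat.Partition k),
            ∃ f : E.CellModule (toLex ⟨k, l⟩) ≃ₗ[ℂ] (KSubset r k →₀ ℂ) ⊗[ℂ] (D k).CellModule l,
              (∀ (x : KSubset r k) (X : M k l), f (E.vec (toLex ⟨k, l⟩) (x, X)) =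
                Finsupp.single x 1 ⊗ₜ (D k).vec l X) ∧
              ∀ (a : Fin r ≃. Fin r) (x : KSubset r k) (s : (D k).CellModule l),
                f (PP.basis r z a • f.symm (Finsupp.single x 1 ⊗ₜ s)) =
                  phi z k a x ⊗ₜ (theta k a x • s)) ∧
          -- they form a complete set of irreducible modules
          (z ≠ 0 →
            (∀ l : Lam r, IsSimpleModule (PP r z) (E.CellModule l)) ∧
            (∀ l m : Lam r,
              Nonempty (E.CellModule l ≃ₗ[PP r z] E.CellModule m) → l = m) ∧
            ∀ (V : Type*) [AddCommGroup V] [Module (PP r z) V] [IsSimpleModule (PP r z) V],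
              ∃ l : Lam r, Nonempty (V ≃ₗ[PP r z] E.CellModule l))) ∧
      -- the cell modules of the `B(k)` may be taken to be the (irreducible) Specht modules
      (∃ (M : ∀ k : Fin (r + 1), Nat.Partition k → Type) (_ : ∀ k l, Fintype (M k l))
        (_ : ∀ k : Fin (r + 1), PartialOrder (Nat.Partition k))
        (D : ∀ k : Fin (r + 1), CellDatum (invol k) (Nat.Partition k) (M k)),
        ∀ (k : Fin (r + 1)) (l : Nat.Partition k) (T : Tableau l),
          IsSimpleModule (SymAlg k) (specht T) ∧
            Nonempty ((D k).CellModule l ≃ₗ[SymAlg k] specht T)) ∧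
      -- the form `ψ` and the product of two elements of one layer
      (∀ k : Fin (r + 1),
        (∀ y u : KSubset r k →₀ ℂ, invol k (psi r z k y u) = psi r z k u y) ∧
        ∀ (x y u v : KSubset r k →₀ ℂ) (c b : SymAlg k),
          layer e k x c y * layer e k u b v - layer e k x (c * psi r z k y u * b) v ∈
            below e k) ∧
      -- semisimplicity
      (z ≠ 0 → IsSemisimpleRing (PP r z)) := by
  refine ⟨layersEquiv r z, fun d => (represents_self d rfl).basis_eq z, isIteratedInflation z,
    ?_, ?_, fun k => ⟨invol_psi z, layer_mul_layer z⟩, ?_⟩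
  · intro M _ _ D
    refine ⟨inflate z D, inflate_C z D, fun k l => ⟨inflateCellModule z D k l,
      inflateCellModule_vec z D k l, inflateCellModule_smul z D k l⟩, fun hz => ⟨?_, ?_, ?_⟩⟩
    · intro l
      have := nonempty_inflate D l
      exact CellDatum.isSimpleModule_cellModule _ (inflate_nondegenerate z D hz l)
    · rintro l m ⟨f⟩
      have := nonempty_inflate D l
      have := nonempty_inflate D m
      exact CellDatum.eq_of_linearEquiv _ (inflate_nondegenerate z D hz l)
        (inflate_nondegenerate z D hz m) f
    · intro V _ _ _
      obtain ⟨l, -, h⟩ :=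
        CellDatum.exists_linearEquiv_cellModule _ (inflate_nondegenerate z D hz) V
      exact ⟨l, h⟩
  · exact ⟨_, inferInstance, fun k => discreteOrder _, fun k => spechtDatum k, fun k l T =>
      ⟨isSimpleModule_specht T, nonempty_spechtDatum_linearEquiv T⟩⟩
  · intro hz
    -- Semisimplicity does not refer to a cell datum, so one must be supplied: the Specht data, with
    -- the discrete orders.
    let (k : Fin (r + 1)) : PartialOrder (Nat.Partition k) := discreteOrder _
    exact CellDatum.isSemisimpleRing _
      (inflate_nondegenerate z (fun k : Fin (r + 1) => spechtDatum k) hz)
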